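/- **Channel.** A transmitter sends two independent uniform messages $W_1,W_2$ of $\lfloor nR_1\rfloor$ and $\lfloor nR_2\rfloor$ bits to receivers $1$ and $2$, respectively, over $n$ uses of a broadcast erasure channel with inputs $X[t]\in\mathbb{F}_2$ and outputs $Y_i[t]=S_i[t]X[t]$, $i=1,2$. The states $S_i[t]\in\{0,1\}$ are independent over $t$ and $i$ and independent of the messages, with $\Pr(S_i[t]=0)=\delta_A$ for $1\le t\le n_A$ (mode $A$), $\delta_T$ for $n_A<t\le n_A+n_T$ (transient mode) and $\delta_B$ for $n_A+n_T<t\le n$ (mode $B$). Here $n_A=n_A(n)$ and $n_T=n_T(n)$ are deterministic with $n_A+n_T\le n$, $n_A/n\to\eta$ and $n_T=o(n)$. The encoder is $X[t]=f_t(W_1,W_2,S^{t-1},\mathrm{SI})$, where $S^{t-1}$ are the states of both links before time $t$. Decoder $i$ knows $Y_i^n$, the states $S^n$ of both links and all channel parameters. A pair $(R_1,R_2)$, $R_1,R_2\ge 0$, is achievable if there are encoders and decoders for which both average error probabilities $\Pr(\widehat W_i\ne W_i)$ tend to $0$ as $n\to\infty$; the capacity region is the closure of the set of achievable pairs. Let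 $\mathcal{C}$ be the capacity region when the side information $\mathrm{SI}$ of the transmitter consists of all of $\delta_A,\delta_T,\delta_B,n_A,n_T$. Let $\mathcal{C}'$ be the capacity region when it consists only of the parameters $\delta_A,\delta_B,n_A$ of the non-transient modes, that is, when the same encoders have to work for every $\delta_T\in[0,1]$ and every $n_T=o(n)$ with $n_A+n_T\le n$. **Regions.** Let $\bar\delta=\eta\delta_A+(1-\eta)\delta_B$, $\beta_{\max}=1+\max\{\delta_A,\delta_B\}$, $\beta_{\min}=1+\min\{\delta_A,\delta_B\}$, and $$\kappa=\mathbb{1}_{\max\{\delta_A,\delta_B\}=\delta_A}\tfrac{\eta}{1+\delta_A}(1-\delta_A^2)+\mathbb{1}_{\max\{\delta_A,\delta_B\}=\delta_B}\tfrac{1-\eta}{1+\delta_B}(1-\delta_B^2).$$ Let $\mathcal{C}_1$ be the set of pairs with $R_1,R_2\ge0$, $\beta_{\max}R_1+R_2\le\beta_{\max}(1-\bar\delta)$ and $R_1+\beta_{\max}R_2\le\beta_{\max}(1-\bar\delta)$. Let $\mathcal{C}_2$ be the set of pairs with $0\le R_1,R_2\le1-\bar\delta$, $\beta_{\min}R_1+R_2\le\beta_{\min}(1-\bar\delta)+\kappa$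 and $R_1+\beta_{\min}R_2\le\beta_{\min}(1-\bar\delta)+\kappa$. Let $\mathcal{C}_3$ be the set of pairs with $0\le R_1,R_2\le1-\bar\delta$ and $0\le R_1+R_2\le\eta(1-\delta_A^2)+(1-\eta)(1-\delta_B^2)$. **Theorem.** Let $0\le\delta_B\le\delta_A\le1$, $\delta_B<1$, and $$\eta\ge\Big(1+\frac{\delta_A(1-\delta_A)}{2(1-\delta_B)}\Big)^{-1}.$$ Then the outer bound $\mathcal{C}_1\cap\mathcal{C}_2\cap\mathcal{C}_3$ reduces to $\mathcal{C}_1$; it equals the capacity region $\mathcal{C}$, for every transient mode $(\delta_T,n_T)$; and it is achievable with transmitter side information about the non-transient modes only, that is, $\mathcal{C}'=\mathcal{C}_1\cap\mathcal{C}_2\cap\mathcal{C}_3$ as well. In particular, the symmetric point $$R_1=R_2=\frac{(1+\delta_A)(1-\bar\delta)}{2+\delta_A}$$ belongs to $\mathcal{C}'$, and it maximizes $R_1+R_2$ over $\mathcal{C}'$. -/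

import Mathlib

open Filter Topology

noncomputable section

namespace BPEC

/-! ### The two-user multi-modal broadcast (packet) erasure channel with delayed channel state
feedback.  Users are indexed by `Fin 2`, packets are elements of `𝔽₂ = ZMod 2`, and the `n` channel
uses are indexed by `Fin n`, so that `t : Fin n` is the `(t + 1)`-st channel use. -/

/-- A realization of the forward channels over `k` channel uses: `s t i = true` when user `i`
receives the input of channel use `t`, and `s t i = false` when it is erased. -/
abbrev States (k : ℕ) : Type := Fin k → Fin 2 → Bool

/-- A pair of messages: the message of user `i` consists of `m i` bits. -/
abbrev Messages (m : Fin 2 → ℕ) : Type := (i : Fin 2) → Fin (m i) → ZMod 2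

/-- A (delayed channel state feedback) encoder: the input of channel use `t` is a function of both
messages and of the states of the channel uses strictly before `t`. -/
abbrev Encoder (n : ℕ) (m : Fin 2 → ℕ) : Type :=
  (t : Fin n) → Messages m → States t.val → ZMod 2

/-- A decoder of one user with a message of `k` bits: it sees the outputs of that user and the
states of all links over the whole block. -/
abbrev Decoder (n k : ℕ) : Type := (Fin n → ZMod 2) → States n → Fin k → ZMod 2

/-- The states of the channel uses strictly before `t`. -/
def pastStates {n : ℕ} (s : States n) (t : Fin n) : States t.val :=
  fun j => s ⟨j.val, j.isLt.trans t.isLt⟩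

/-- The channel output `Y_i[t] = S_i[t] X[t]` of user `i`. -/
def output {n : ℕ} {m : Fin 2 → ℕ} (enc : Encoder n m) (w : Messages m) (s : States n)
    (i : Fin 2) (t : Fin n) : ZMod 2 :=
  if s t i then enc t w (pastStates s t) else 0

/-- The erasure probability of channel use `t` (counted from `0`): first `nA` uses of mode A, then
`nT` uses of the transient mode, and mode B afterwards. -/
def erasureProb (δA δT δB : ℝ) (nA nT t : ℕ) : ℝ :=
  if t < nA then δA else if t < nA + nT then δT else δB

/-- The probability of the state realization `s` when all links are independent, over time and
across users, and channel use `t` is erased with probability `δ t` on either link. -/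
def stateProb {n : ℕ} (δ : ℕ → ℝ) (s : States n) : ℝ :=
  ∏ t : Fin n, ∏ i : Fin 2, if s t i then 1 - δ t else δ t

/-- The average probability that user `i` decodes its message wrongly, the two messages being
uniform, independent of each other and of the channel states. -/
def errorProb {n : ℕ} {m : Fin 2 → ℕ} (δ : ℕ → ℝ) (enc : Encoder n m) (i : Fin 2)
    (dec : Decoder n (m i)) : ℝ :=
  (∑ w : Messages m, ∑ s : States n,
      if dec (output enc w s i) s ≠ w i then stateProb δ s else 0) /
    (Fintype.card (Messages m) : ℝ)

/-- The number of bits of the message of user `i` at rate `R i` and blocklength `n`. -/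
def msgLen (R : Fin 2 → ℝ) (n : ℕ) (i : Fin 2) : ℕ := ⌊(n : ℝ) * R i⌋₊

/-- `nT n` is the length of a transient mode at blocklength `n`, following `nA n` channel uses of
the first non-transient mode: it fits into the block and is `o(n)`. -/
def IsTransient (nA nT : ℕ → ℕ) : Prop :=
  (∀ n, nA n + nT n ≤ n) ∧ Tendsto (fun n => (nT n : ℝ) / (n : ℝ)) atTop (𝓝 0)

/-- Given the encoders `enc n`, every user has decoders whose error probabilities tend to `0`.
The decoders may depend on all channel parameters. -/
def Decodable (δA δT δB : ℝ) (nA nT : ℕ → ℕ) (R : Fin 2 → ℝ)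
    (enc : (n : ℕ) → Encoder n (msgLen R n)) : Prop :=
  ∀ i : Fin 2, ∃ dec : (n : ℕ) → Decoder n (msgLen R n i),
    Tendsto (fun n => errorProb (erasureProb δA δT δB (nA n) (nT n)) (enc n) i (dec n))
      atTop (𝓝 0)

/-- Achievability of a rate pair when the transmitter knows all channel parameters: the encoders
may depend on the erasure probabilities and on the lengths of all modes. -/
def Achievable (δA δT δB : ℝ) (nA nT : ℕ → ℕ) (R : Fin 2 → ℝ) : Prop :=
  (∀ i, 0 ≤ R i) ∧
    ∃ enc : (n : ℕ) → Encoder n (msgLen R n), Decodable δA δT δB nA nT R enc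

/-- Achievability of a rate pair when the transmitter knows only the parameters `δA`, `δB`, `nA`
of the non-transient modes: the same encoders have to work for every erasure probability and every
length of the transient mode. -/
def AchievableNonTransientSI (δA δB : ℝ) (nA : ℕ → ℕ) (R : Fin 2 → ℝ) : Prop :=
  (∀ i, 0 ≤ R i) ∧
    ∃ enc : (n : ℕ) → Encoder n (msgLen R n),
      ∀ (δT : ℝ) (nT : ℕ → ℕ), 0 ≤ δT → δT ≤ 1 → IsTransient nA nT →
        Decodable δA δT δB nA nT R enc

/-- The capacity region, the transmitter knowing all channel parameters. -/
def capacityRegion (δA δT δB : ℝ) (nA nT : ℕ → ℕ) : Set (Fin 2 → ℝ) :=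
  closure {R | Achievable δA δT δB nA nT R}

/-- The capacity region, the transmitter knowing only the parameters of the non-transient modes. -/
def capacityRegionNonTransientSI (δA δB : ℝ) (nA : ℕ → ℕ) : Set (Fin 2 → ℝ) :=
  closure {R | AchievableNonTransientSI δA δB nA R}

/-! ### The outer-bound regions; `η` is the limit of `nA n / n`. -/

/-- The average erasure probability. -/
def avgErasure (δA δB η : ℝ) : ℝ := η * δA + (1 - η) * δB

def betaMax (δA δB : ℝ) : ℝ := max (1 + δA) (1 + δB)

def betaMin (δA δB : ℝ) : ℝ := min (1 + δA) (1 + δB)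

def kappa (δA δB η : ℝ) : ℝ :=
  (if max δA δB = δA then η / (1 + δA) * (1 - δA ^ 2) else 0) +
    (if max δA δB = δB then (1 - η) / (1 + δB) * (1 - δB ^ 2) else 0)

def regionC1 (δA δB η : ℝ) : Set (Fin 2 → ℝ) :=
  {R | 0 ≤ R 0 ∧ 0 ≤ R 1 ∧
    betaMax δA δB * R 0 + R 1 ≤ betaMax δA δB * (1 - avgErasure δA δB η) ∧
    R 0 + betaMax δA δB * R 1 ≤ betaMax δA δB * (1 - avgErasure δA δB η)}

def regionC2 (δA δB η : ℝ) : Set (Fin 2 → ℝ) :=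
  {R | (∀ i, 0 ≤ R i ∧ R i ≤ 1 - avgErasure δA δB η) ∧
    betaMin δA δB * R 0 + R 1 ≤
      betaMin δA δB * (1 - avgErasure δA δB η) + kappa δA δB η ∧
    R 0 + betaMin δA δB * R 1 ≤
      betaMin δA δB * (1 - avgErasure δA δB η) + kappa δA δB η}

def regionC3 (δA δB η : ℝ) : Set (Fin 2 → ℝ) :=
  {R | (∀ i, 0 ≤ R i ∧ R i ≤ 1 - avgErasure δA δB η) ∧
    0 ≤ R 0 + R 1 ∧ R 0 + R 1 ≤ η * (1 - δA ^ 2) + (1 - η) * (1 - δB ^ 2)}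

/-- The outer-bound region. -/
def outerBound (δA δB η : ℝ) : Set (Fin 2 → ℝ) :=
  regionC1 δA δB η ∩ regionC2 δA δB η ∩ regionC3 δA δB η

end BPEC

end

/-! Everything is squeezed between two inclusions: C₁ ⊆ C′ by a queueing scheme that ignores the
transient mode, and C′ ⊆ C ⊆ C₁ by an entropy argument.

Converse. For a fixed state realization the uniform messages form a finite probability space. An
input depends only on earlier states, so the current state is independent of the conditional entropy
of that input. Hence in one use with erasure probability δ, a single output gains (1 - δ) H(X | own
past) on average and both outputs gain (1 - δ²) H(X | both pasts), where the second conditional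
entropy is the smaller one. Since 1 - δ² = (1 + δ)(1 - δ), H(Y₁, Y₂ | Wᵢ) is at most (1 + δA) H(Yᵢ |
Wᵢ), up to O(1) per transient use (`expect_ent_view_univ_le`). By Fano the left side is at least
about nRⱼ and H(Yᵢ | Wᵢ) at most about n(1 - δ̄) - nRᵢ. This gives the two facets of C₁
(`converse_bound`, `Achievable.weighted_sum_le`).

Achievability. About nRᵢ/(1 - δA²) uses of mode A are dedicated to user i, each packet being
repeated until somebody receives it. Packets caught only by the wrong user are later sent as sums,
useful to both users at once. That the joint uses can drain these packets is exactly the facet of C₁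
with weight 1 + δA on Rᵢ; that the dedicated uses fit into mode A is R₁ + R₂ ≤ η(1 - δA²)
(`achievableNonTransientSI_of_lt`). The hypothesis on η says that this last bound holds at the
symmetric vertex, which maximizes the sum-rate over C₁, so it holds on all of C₁ (`add_le_mode_A`).
The same slack makes C₂ and C₃ redundant (`outerBound_eq_regionC1`). -/

noncomputable section

namespace BPEC

/-! ### Expectation over independent channel states -/

/-- The probability of the states of both links in a channel use with erasure probability `p`. -/
def linkProb (p : ℝ) (a : Fin 2 → Bool) : ℝ := ∏ i, if a i then 1 - p else p

/-- The expectation of a function of the channel states. -/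
def expect {n : ℕ} (δ : ℕ → ℝ) (φ : States n → ℝ) : ℝ := ∑ s, stateProb δ s * φ s

lemma stateProb_eq {n : ℕ} (δ : ℕ → ℝ) (s : States n) :
    stateProb δ s = ∏ t : Fin n, linkProb (δ t) (s t) := rfl

lemma linkProb_nonneg {p : ℝ} (h0 : 0 ≤ p) (h1 : p ≤ 1) (a : Fin 2 → Bool) :
    0 ≤ linkProb p a := by
  refine Finset.prod_nonneg fun i _ => ?_
  split_ifs <;> linarith

/-- Summation over the states of both links in one channel use. -/
lemma sum_link (G : (Fin 2 → Bool) → ℝ) :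
    ∑ a, G a = G ![true, true] + G ![true, false] + G ![false, true] + G ![false, false] := by
  rw [← (finTwoArrowEquiv Bool).symm.sum_comp, Fintype.sum_prod_type]
  simp [finTwoArrowEquiv]
  ring

lemma sum_linkProb (p : ℝ) : ∑ a, linkProb p a = 1 := by
  rw [sum_link]
  simp [linkProb, Fin.prod_univ_two]
  ring

lemma stateProb_nonneg {n : ℕ} {δ : ℕ → ℝ} (h0 : ∀ t, 0 ≤ δ t) (h1 : ∀ t, δ t ≤ 1)
    (s : States n) : 0 ≤ stateProb δ s := by
  rw [stateProb_eq]
  exact Finset.prod_nonneg fun t _ => linkProb_nonneg (h0 t) (h1 t) _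

section

variable {n : ℕ} {δ : ℕ → ℝ}

lemma sum_stateProb : ∑ s : States n, stateProb δ s = 1 := by
  have h := Finset.prod_univ_sum (fun _ : Fin n => (Finset.univ : Finset (Fin 2 → Bool)))
    (fun t a => linkProb (δ t) a)
  simp only [sum_linkProb, Finset.prod_const_one, Fintype.piFinset_univ] at h
  exact h.symm

lemma expect_const (c : ℝ) : expect (n := n) δ (fun _ => c) = c := by
  simp [expect, ← Finset.sum_mul, sum_stateProb]

lemma expect_add (φ ψ : States n → ℝ) :
    expect δ (fun s => φ s + ψ s) = expect δ φ + expect δ ψ := by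
  simp [expect, mul_add, Finset.sum_add_distrib]

lemma expect_sub (φ ψ : States n → ℝ) :
    expect δ (fun s => φ s - ψ s) = expect δ φ - expect δ ψ := by
  simp [expect, mul_sub, Finset.sum_sub_distrib]

lemma expect_mul_left (c : ℝ) (φ : States n → ℝ) :
    expect δ (fun s => c * φ s) = c * expect δ φ := by
  simp only [expect, Finset.mul_sum]
  exact Finset.sum_congr rfl fun s _ => by ring

lemma expect_sum {ι : Type*} (I : Finset ι) (φ : ι → States n → ℝ) :
    expect δ (fun s => ∑ j ∈ I, φ j s) = ∑ j ∈ I, expect δ (φ j) := by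
  simp only [expect, Finset.mul_sum]
  exact Finset.sum_comm

lemma expect_mono (h0 : ∀ t, 0 ≤ δ t) (h1 : ∀ t, δ t ≤ 1) {φ ψ : States n → ℝ}
    (h : ∀ s, φ s ≤ ψ s) : expect δ φ ≤ expect δ ψ :=
  Finset.sum_le_sum fun s _ => mul_le_mul_of_nonneg_left (h s) (stateProb_nonneg h0 h1 s)

/-- The states of channel use `t` are independent of those of the other channel uses. -/
lemma expect_mul_of_indep (t : Fin n) (F : (Fin 2 → Bool) → ℝ) (φ : States n → ℝ)
    (hφ : ∀ s a, φ (Function.update s t a) = φ s) :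
    expect δ (fun s => F (s t) * φ s) = (∑ a, linkProb (δ t) a * F a) * expect δ φ := by
  classical
  let e := Equiv.funSplitAt t (Fin 2 → Bool)
  let d : Fin 2 → Bool := fun _ => false
  have he : ∀ a r, e.symm (a, r) t = a := fun a r => by simp [e]
  have hup : ∀ a r, e.symm (a, r) = Function.update (e.symm (d, r)) t a := by
    intro a r
    ext1 j
    by_cases hj : j = t
    · subst hj; simp [e]
    · simp [e, hj]
  have hφ' : ∀ a r, φ (e.symm (a, r)) = φ (e.symm (d, r)) := fun a r => by rw [hup, hφ]
  have hP : ∀ a r, stateProb δ (e.symm (a, r)) =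
      linkProb (δ t) a * ∏ j ∈ {t}ᶜ, linkProb (δ j) (e.symm (d, r) j) := by
    intro a r
    rw [stateProb_eq, Fintype.prod_eq_mul_prod_compl t, he]
    congr 1
    refine Finset.prod_congr rfl fun j hj => ?_
    rw [hup, Function.update_of_ne (by simpa using hj)]
  have key : ∀ F : (Fin 2 → Bool) → ℝ, expect δ (fun s => F (s t) * φ s) =
      (∑ a, linkProb (δ t) a * F a) *
        ∑ r, (∏ j ∈ {t}ᶜ, linkProb (δ j) (e.symm (d, r) j)) * φ (e.symm (d, r)) := by
    intro F
    rw [expect, ← e.symm.sum_comp, Fintype.sum_prod_type, Finset.sum_mul]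
    refine Finset.sum_congr rfl fun a _ => ?_
    rw [Finset.mul_sum]
    refine Finset.sum_congr rfl fun r _ => ?_
    rw [hP, hφ', he]
    ring
  -- The constant function identifies the sum over the remaining coordinates as the expectation of
  -- `φ`.
  have h1 := key (fun _ => 1)
  simp only [one_mul, mul_one, sum_linkProb] at h1
  rw [key F]
  congr 1
  exact h1.symm

/-- The mean of a function of the states of one channel use. -/
def linkMean (p : ℝ) (F : (Fin 2 → Bool) → ℝ) : ℝ := ∑ a, linkProb p a * F a

lemma linkMean_mem_Icc {p : ℝ} (h0 : 0 ≤ p) (h1 : p ≤ 1) {F : (Fin 2 → Bool) → ℝ}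
    (hF : ∀ a, F a ∈ Set.Icc (0 : ℝ) 1) : linkMean p F ∈ Set.Icc (0 : ℝ) 1 := by
  constructor
  · exact Finset.sum_nonneg fun a _ => mul_nonneg (linkProb_nonneg h0 h1 a) (hF a).1
  · rw [← sum_linkProb p]
    exact Finset.sum_le_sum fun a _ =>
      mul_le_of_le_one_right (linkProb_nonneg h0 h1 a) (hF a).2

/-- Centred functions of different channel uses are uncorrelated, so only the diagonal survives, and
each variance is at most 1. -/
lemma expect_sq_sum_sub_linkMean_le (h0 : ∀ t, 0 ≤ δ t) (h1 : ∀ t, δ t ≤ 1)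
    (f : Fin n → (Fin 2 → Bool) → ℝ) (hf : ∀ t a, f t a ∈ Set.Icc (0 : ℝ) 1) :
    expect δ (fun s => (∑ t, f t (s t) - ∑ t : Fin n, linkMean (δ t) (f t)) ^ 2) ≤ n := by
  set g : Fin n → (Fin 2 → Bool) → ℝ := fun t a => f t a - linkMean (δ t) (f t) with hg
  have hg0 : ∀ t : Fin n, ∑ a, linkProb (δ t) a * g t a = 0 := by
    intro t
    simp only [hg, mul_sub, Finset.sum_sub_distrib, ← Finset.sum_mul, sum_linkProb, one_mul]
    simp [linkMean]
  have hoff : ∀ t u, t ≠ u → expect δ (fun s => g t (s t) * g u (s u)) = 0 := by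
    intro t u htu
    rw [expect_mul_of_indep t (g t) (fun s => g u (s u)), hg0, zero_mul]
    intro s a
    rw [Function.update_of_ne htu.symm]
  calc expect δ (fun s => (∑ t, f t (s t) - ∑ t : Fin n, linkMean (δ t) (f t)) ^ 2)
      = expect δ (fun s => ∑ t, ∑ u, g t (s t) * g u (s u)) := by
        congr 1
        ext s
        rw [← Finset.sum_sub_distrib, sq, Finset.sum_mul_sum]
    _ = ∑ t, ∑ u, expect δ (fun s => g t (s t) * g u (s u)) := by
        rw [expect_sum]
        exact Finset.sum_congr rfl fun t _ => expect_sum _ _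
    _ = ∑ t, expect δ (fun s => g t (s t) * g t (s t)) := by
        refine Finset.sum_congr rfl fun t _ => ?_
        rw [Finset.sum_eq_single t (fun u _ hu => hoff t u hu.symm) (by simp)]
    _ ≤ ∑ t : Fin n, (1 : ℝ) := by
        refine Finset.sum_le_sum fun t _ => ?_
        rw [← expect_const (n := n) (δ := δ) 1]
        refine expect_mono h0 h1 fun s => ?_
        have ha := hf t (s t)
        have hb := linkMean_mem_Icc (h0 t) (h1 t) (hf t)
        simp only [hg]
        have := ha.1; have := ha.2; have := hb.1; have := hb.2
        nlinarith
    _ = n := by simp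

open Classical in
/-- Chebyshev's inequality for a sum of independent functions of the single channel uses. -/
lemma expect_deviation_le (h0 : ∀ t, 0 ≤ δ t) (h1 : ∀ t, δ t ≤ 1)
    (f : Fin n → (Fin 2 → Bool) → ℝ) (hf : ∀ t a, f t a ∈ Set.Icc (0 : ℝ) 1)
    {x : ℝ} (hx : 0 < x) :
    expect δ (fun s => if x ≤ |∑ t, f t (s t) - ∑ t : Fin n, linkMean (δ t) (f t)| then 1 else 0)
      ≤ n / x ^ 2 := by
  rw [le_div_iff₀ (by positivity), mul_comm, ← expect_mul_left]
  refine le_trans (expect_mono h0 h1 fun s => ?_) (expect_sq_sum_sub_linkMean_le h0 h1 f hf)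
  split_ifs with h
  · rw [mul_one, ← sq_abs (∑ t, f t (s t) - _)]
    gcongr
  · rw [mul_zero]
    positivity

end

/-! ### Entropy of functions of a uniform variable on a finite type -/

section

variable {Ω α β ξ : Type*} [Fintype Ω]

open Classical in
/-- The number of points at which `f` takes the same value as at `w`. -/
def fiberCard (f : Ω → α) (w : Ω) : ℝ := ((Finset.univ.filter fun v => f v = f w).card : ℝ)

/-- The entropy (in nats) of `f` under the uniform distribution on `Ω`. -/
def ent (f : Ω → α) : ℝ :=
  (∑ w, Real.log (Fintype.card Ω / fiberCard f w)) / Fintype.card Ω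

lemma fiberCard_pos (f : Ω → α) (w : Ω) : 0 < fiberCard f w := by
  classical
  have : 0 < (Finset.univ.filter fun v => f v = f w).card :=
    Finset.card_pos.2 ⟨w, by simp⟩
  unfold fiberCard
  exact_mod_cast this

lemma fiberCard_mono {f : Ω → α} {g : Ω → β} (h : ∀ v w, f v = f w → g v = g w) (w : Ω) :
    fiberCard f w ≤ fiberCard g w := by
  classical
  unfold fiberCard
  norm_cast
  refine Finset.card_le_card fun v hv => ?_
  simp only [Finset.mem_filter, Finset.mem_univ, true_and] at hv ⊢
  exact h _ _ hv

lemma ent_mono {f : Ω → α} {g : Ω → β} (h : ∀ v w, f v = f w → g v = g w) : ent g ≤ ent f := by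
  rcases isEmpty_or_nonempty Ω with hΩ | hΩ
  · simp [ent]
  have hN : (0 : ℝ) < Fintype.card Ω := by exact_mod_cast Fintype.card_pos
  unfold ent
  gcongr with w
  · exact div_pos hN (fiberCard_pos g w)
  · exact fiberCard_pos f w
  · exact fiberCard_mono h w

lemma ent_congr {f : Ω → α} {g : Ω → β} (h : ∀ v w, f v = f w ↔ g v = g w) : ent f = ent g :=
  le_antisymm (ent_mono fun v w => (h v w).2) (ent_mono fun v w => (h v w).1)

lemma ent_of_fiberCard [Nonempty Ω] {f : Ω → α} {c : ℝ} (h : ∀ w, fiberCard f w = c) :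
    ent f = Real.log (Fintype.card Ω / c) := by
  have hN : (Fintype.card Ω : ℝ) ≠ 0 := by exact_mod_cast Fintype.card_ne_zero
  simp [ent, h, hN]

/-- The difference plays the role of H(x | f) throughout: the ratio of fiber sizes is the reciprocal
of the conditional probability of `x w` given `f w`. -/
lemma ent_pair_sub (f : Ω → α) (x : Ω → ξ) :
    ent (fun w => (f w, x w)) - ent f =
      (∑ w, Real.log (fiberCard f w / fiberCard (fun v => (f v, x v)) w)) / Fintype.card Ω := by
  rcases isEmpty_or_nonempty Ω with hΩ | hΩ
  · simp [ent]
  have hN : (Fintype.card Ω : ℝ) ≠ 0 := by exact_mod_cast Fintype.card_ne_zero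
  unfold ent
  rw [← sub_div, ← Finset.sum_sub_distrib]
  congr 1
  refine Finset.sum_congr rfl fun w _ => ?_
  have h1 := (fiberCard_pos f w).ne'
  have h2 := (fiberCard_pos (fun v => (f v, x v)) w).ne'
  rw [Real.log_div hN h2, Real.log_div hN h1, Real.log_div h1 h2]
  ring

/-- Summing over fibers: a kernel of total mass at most one, weighted by conditional
probabilities, has mean at most one. -/
lemma sum_mul_fiberCard_div_le [Fintype ξ] (f : Ω → α) (x : Ω → ξ) (q : α → ξ → ℝ)
    (hq0 : ∀ a b, 0 ≤ q a b) (hq1 : ∀ a, ∑ b, q a b ≤ 1) :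
    ∑ w, q (f w) (x w) * (fiberCard f w / fiberCard (fun v => (f v, x v)) w)
      ≤ Fintype.card Ω := by
  classical
  have h1 : ∀ w, q (f w) (x w) * (fiberCard f w / fiberCard (fun v => (f v, x v)) w) =
      ∑ v, if f v = f w then
        q (f w) (x w) / fiberCard (fun v => (f v, x v)) w else 0 := by
    intro w
    rw [← Finset.sum_filter, Finset.sum_const, nsmul_eq_mul, fiberCard]
    ring
  simp only [h1]
  -- With the fiber size expanded as a count over `v`, the sums are exchanged. For fixed `v`, the
  -- fiber of `f` splits into cells by the value `b` of `x`, and each nonempty cell contributes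
  -- exactly `q (f v) b`.
  rw [Finset.sum_comm]
  have h2 : ∀ v, (∑ w, if f v = f w then
      q (f w) (x w) / fiberCard (fun v => (f v, x v)) w else 0) ≤ 1 := by
    intro v
    refine le_trans ?_ (hq1 (f v))
    rw [← Finset.sum_fiberwise (s := Finset.univ) (g := x)]
    refine Finset.sum_le_sum fun b _ => ?_
    rw [← Finset.sum_filter, Finset.filter_filter]
    set S := Finset.univ.filter (fun w => x w = b ∧ f v = f w) with hS
    have h3 : ∀ w ∈ S, q (f w) (x w) / fiberCard (fun v => (f v, x v)) w =
        q (f v) b / (S.card : ℝ) := by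
      intro w hw
      simp only [hS, Finset.mem_filter, Finset.mem_univ, true_and] at hw
      rw [← hw.2, hw.1, fiberCard]
      congr 3
      ext u
      simp only [hS, Finset.mem_filter, Finset.mem_univ, true_and, Prod.mk.injEq, hw.1, ← hw.2]
      constructor
      · rintro ⟨h, h'⟩; exact ⟨h', h.symm⟩
      · rintro ⟨h, h'⟩; exact ⟨h'.symm, h⟩
    rw [Finset.sum_congr rfl h3, Finset.sum_const, nsmul_eq_mul]
    rcases Nat.eq_zero_or_pos S.card with h | h
    · simp [h, hq0]
    · have : (S.card : ℝ) ≠ 0 := by positivity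
      rw [mul_div_cancel₀ _ this]
  calc _ ≤ ∑ v : Ω, (1 : ℝ) := Finset.sum_le_sum fun v _ => h2 v
    _ = _ := by simp

/-- Gibbs' inequality for conditional entropies. -/
lemma ent_pair_sub_le [Fintype ξ] (f : Ω → α) (x : Ω → ξ) (q : α → ξ → ℝ)
    (hq0 : ∀ a b, 0 ≤ q a b) (hq1 : ∀ a, ∑ b, q a b ≤ 1) (hq : ∀ w, 0 < q (f w) (x w)) :
    ent (fun w => (f w, x w)) - ent f ≤
      (∑ w, -Real.log (q (f w) (x w))) / Fintype.card Ω := by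
  rw [ent_pair_sub]
  gcongr ?_ / _
  have h := sum_mul_fiberCard_div_le f x q hq0 hq1
  have h2 : ∑ w, (Real.log (fiberCard f w / fiberCard (fun v => (f v, x v)) w) +
      Real.log (q (f w) (x w))) ≤
      ∑ w, (q (f w) (x w) * (fiberCard f w / fiberCard (fun v => (f v, x v)) w) - 1) := by
    refine Finset.sum_le_sum fun w _ => ?_
    have hpos := div_pos (fiberCard_pos f w) (fiberCard_pos (fun v => (f v, x v)) w)
    rw [← Real.log_mul hpos.ne' (hq w).ne', mul_comm]
    exact Real.log_le_sub_one_of_pos (mul_pos (hq w) hpos)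
  rw [Finset.sum_add_distrib, Finset.sum_sub_distrib] at h2
  simp only [Finset.sum_const, Finset.card_univ, nsmul_eq_mul, mul_one] at h2
  rw [Finset.sum_neg_distrib]
  linarith

lemma ent_pair_sub_nonneg (f : Ω → α) (x : Ω → ξ) :
    0 ≤ ent (fun w => (f w, x w)) - ent f :=
  sub_nonneg.2 (ent_mono fun _ _ h => (Prod.mk.inj h).1)

/-- Gibbs' inequality with the uniform kernel. -/
lemma ent_pair_sub_le_log_card [Fintype ξ] [Nonempty Ω] (f : Ω → α) (x : Ω → ξ) :
    ent (fun w => (f w, x w)) - ent f ≤ Real.log (Fintype.card ξ) := by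
  have hξ : Nonempty ξ := ⟨x (Classical.arbitrary Ω)⟩
  have hk : (0 : ℝ) < Fintype.card ξ := by exact_mod_cast Fintype.card_pos
  have hN : (Fintype.card Ω : ℝ) ≠ 0 := by exact_mod_cast Fintype.card_ne_zero
  refine (ent_pair_sub_le f x (fun _ _ => (Fintype.card ξ : ℝ)⁻¹) (fun _ _ => by positivity)
    (fun _ => ?_) (fun _ => by positivity)).trans_eq ?_
  · simp [hk.ne']
  · simp [hN]

/-- Conditioning reduces entropy. -/
lemma ent_pair_sub_anti [Fintype ξ] (f : Ω → α) (g : Ω → β) (x : Ω → ξ)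
    (hfg : ∀ v w, g v = g w → f v = f w) :
    ent (fun w => (g w, x w)) - ent g ≤ ent (fun w => (f w, x w)) - ent f := by
  classical
  rw [ent_pair_sub f x]
  let c : α → ξ → ℝ := fun a b => ((Finset.univ.filter fun v => f v = a ∧ x v = b).card : ℝ)
  let d : α → ℝ := fun a => ((Finset.univ.filter fun v => f v = a).card : ℝ)
  have hd : ∀ a, ∑ b, c a b = d a := by
    intro a
    simp only [c, d]
    norm_cast
    rw [Finset.card_eq_sum_card_fiberwise (f := x) (t := Finset.univ) (by simp)]
    simp [Finset.filter_filter]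
  have hc : ∀ w, c (f w) (x w) = fiberCard (fun v => (f v, x v)) w := by
    intro w
    simp [c, fiberCard]
  -- Gibbs' inequality, conditioning on `(g, f)` but using as kernel the true conditional law of `x`
  -- given `f`. Since `g` determines `f`, the extra component changes no entropy.
  have h := ent_pair_sub_le (fun w => (g w, f w)) x (fun a b => c a.2 b / d a.2)
    (fun _ _ => by positivity)
    (fun a => by rw [← Finset.sum_div, hd]; exact div_self_le_one _)
    (fun w => by
      simp only [hc]
      exact div_pos (fiberCard_pos _ _) (fiberCard_pos f w))
  have e1 : ent (fun w => ((g w, f w), x w)) = ent (fun w => (g w, x w)) :=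
    ent_congr fun v w => by
      simp only [Prod.mk.injEq]
      exact ⟨fun h => ⟨h.1.1, h.2⟩, fun h => ⟨⟨h.1, hfg _ _ h.1⟩, h.2⟩⟩
  have e2 : ent (fun w => (g w, f w)) = ent g :=
    ent_congr fun v w => by
      simp only [Prod.mk.injEq]
      exact ⟨fun h => h.1, fun h => ⟨h, hfg _ _ h⟩⟩
  rw [e1, e2] at h
  refine h.trans_eq ?_
  congr 1
  refine Finset.sum_congr rfl fun w _ => ?_
  simp only [hc]
  rw [← Real.log_inv, inv_div]
  rfl

/-- Fano's inequality. -/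
lemma ent_pair_sub_le_fano [Fintype ξ] [DecidableEq ξ] [Nonempty Ω] (f : Ω → α) (x : Ω → ξ)
    (dec : α → ξ) :
    ent (fun w => (f w, x w)) - ent f ≤ Real.log 2 +
      (∑ w, if dec (f w) ≠ x w then 1 else 0) / Fintype.card Ω * Real.log (Fintype.card ξ) := by
  have hξ : Nonempty ξ := ⟨x (Classical.arbitrary Ω)⟩
  have hk : (0 : ℝ) < Fintype.card ξ := by exact_mod_cast Fintype.card_pos
  have hN : (Fintype.card Ω : ℝ) ≠ 0 := by exact_mod_cast Fintype.card_ne_zero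
  set k : ℝ := (Fintype.card ξ : ℝ) with hkdef
  refine (ent_pair_sub_le f x
    -- Half the mass sits on the decoder's guess and half is uniform: a correct guess costs at most
    -- log 2, a wrong one log 2 + log k.
    (fun a b => (if dec a = b then 2⁻¹ else 0) + 2⁻¹ * k⁻¹)
    (fun _ _ => by positivity) (fun a => ?_)
    (fun _ => by positivity)).trans ?_
  · rw [Finset.sum_add_distrib]
    simp [← hkdef]
    field_simp
    norm_num
  · rw [div_mul_eq_mul_div, add_div' _ _ _ hN]
    gcongr ?_ / _
    rw [Finset.sum_mul, mul_comm (Real.log 2), ← nsmul_eq_mul, ← Finset.card_univ,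
      ← Finset.sum_const, ← Finset.sum_add_distrib]
    refine Finset.sum_le_sum fun w _ => ?_
    by_cases h : dec (f w) = x w
    · simp only [h, if_true, ne_eq, not_true_eq_false, if_false, zero_mul, add_zero]
      rw [← Real.log_inv]
      refine Real.log_le_log (by positivity) ?_
      rw [inv_le_comm₀ (by positivity) (by positivity)]
      have : 0 ≤ (2 : ℝ)⁻¹ * k⁻¹ := by positivity
      linarith
    · simp only [h, if_false, ne_eq, not_false_eq_true, if_true, zero_add, one_mul]
      rw [← mul_inv, Real.log_inv, neg_neg, Real.log_mul two_ne_zero hk.ne']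

end

/-! ### The converse -/

lemma linkMean_single (p : ℝ) (i : Fin 2) :
    linkMean p (fun a => if ∃ k ∈ ({i} : Finset (Fin 2)), a k then 1 else 0) = 1 - p := by
  rw [linkMean, sum_link]
  fin_cases i <;> simp [linkProb, Fin.prod_univ_two] <;> ring

lemma linkMean_univ (p : ℝ) :
    linkMean p (fun a => if ∃ k ∈ (Finset.univ : Finset (Fin 2)), a k then 1 else 0) =
      1 - p ^ 2 := by
  rw [linkMean, sum_link]
  simp [linkProb, Fin.prod_univ_two]
  ring

section

variable {n : ℕ} {m : Fin 2 → ℕ} {γ : Type*}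

lemma pastStates_update {s : States n} {t u : Fin n} (h : u ≤ t) (a : Fin 2 → Bool) :
    pastStates (Function.update s t a) u = pastStates s u := by
  ext1 j
  refine Function.update_of_ne (fun he => ?_) _ _
  have h1 := congrArg Fin.val he
  have h2 := j.isLt
  simp only at h1
  have h3 : u.val ≤ t.val := h
  omega

/-- What is known after `t` channel uses from `b` and from the outputs of the users in `U`. -/
def view (enc : Encoder n m) (b : Messages m → γ) (U : Finset (Fin 2)) (s : States n) (t : ℕ)
    (w : Messages m) : γ × (Fin n → Fin 2 → ZMod 2) :=
  (b w, fun u k => if u.val < t ∧ k ∈ U then output enc w s k u else 0)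

variable (enc : Encoder n m) (b : Messages m → γ) (U : Finset (Fin 2))

lemma view_eq_iff {s : States n} {t : ℕ} {v w : Messages m} :
    view enc b U s t v = view enc b U s t w ↔ b v = b w ∧
      ∀ u : Fin n, u.val < t → ∀ k ∈ U, output enc v s k u = output enc w s k u := by
  simp only [view, Prod.mk.injEq, funext_iff]
  refine and_congr_right fun _ => ⟨fun h u hu k hk => ?_, fun h u k => ?_⟩
  · simpa [hu, hk] using h u k
  · split_ifs with hc
    · exact h u hc.1 k hc.2
    · rfl

lemma view_update (s : States n) (t : Fin n) (a : Fin 2 → Bool) (w : Messages m) :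
    view enc b U (Function.update s t a) t w = view enc b U s t w := by
  simp only [view, Prod.mk.injEq, true_and]
  ext u k
  split_ifs with h
  · have hne : u ≠ t := fun he => by subst he; exact lt_irrefl _ h.1
    rw [output, output, pastStates_update (le_of_lt h.1), Function.update_of_ne hne]
  · rfl

/-- The entropy of the input of channel use `t`, given a view of the past. -/
def inputEnt (s : States n) (t : Fin n) : ℝ :=
  ent (fun w => (view enc b U s t w, enc t w (pastStates s t))) - ent (view enc b U s t)

/-- Causality of the feedback enters here. It makes `expect_mul_of_indep` applicable to the entropy
increment of each channel use. -/
lemma inputEnt_update (s : States n) (t : Fin n) (a : Fin 2 → Bool) :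
    inputEnt enc b U (Function.update s t a) t = inputEnt enc b U s t := by
  have h : view enc b U (Function.update s t a) t = view enc b U s t :=
    funext (view_update enc b U s t a)
  rw [inputEnt, inputEnt, h, pastStates_update le_rfl]

lemma inputEnt_nonneg (s : States n) (t : Fin n) : 0 ≤ inputEnt enc b U s t :=
  ent_pair_sub_nonneg _ _

lemma inputEnt_le (s : States n) (t : Fin n) : inputEnt enc b U s t ≤ Real.log 2 :=
  (ent_pair_sub_le_log_card _ _).trans_eq (by simp [ZMod.card])

lemma inputEnt_anti {U V : Finset (Fin 2)} (h : U ⊆ V) (s : States n) (t : Fin n) :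
    inputEnt enc b V s t ≤ inputEnt enc b U s t := by
  refine ent_pair_sub_anti _ _ _ fun v w hvw => ?_
  rw [view_eq_iff] at hvw ⊢
  exact ⟨hvw.1, fun u hu k hk => hvw.2 u hu k (h hk)⟩

/-- The chain rule: if some user in `U` receives, the new outputs reveal the input itself; otherwise
they are all 0 and reveal nothing. -/
lemma ent_view_succ (s : States n) (t : Fin n) :
    ent (view enc b U s (t + 1)) = ent (view enc b U s t) +
      (if ∃ k ∈ U, s t k then 1 else 0) * inputEnt enc b U s t := by
  split_ifs with h
  · rw [inputEnt, one_mul, add_sub_cancel]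
    refine ent_congr fun v w => ?_
    simp only [Prod.mk.injEq, view_eq_iff, and_assoc]
    refine and_congr_right fun _ => ⟨fun hs => ⟨fun u hu => hs u (by omega), ?_⟩, ?_⟩
    · obtain ⟨k, hk, hsk⟩ := h
      simpa [output, hsk] using hs t (by omega) k hk
    · rintro ⟨h1, h2⟩ u hu k hk
      rcases Nat.lt_succ_iff_lt_or_eq.1 hu with hlt | heq
      · exact h1 u hlt k hk
      · rw [Fin.ext heq, output, output, h2]
  · rw [zero_mul, add_zero]
    refine ent_congr fun v w => ?_
    simp only [view_eq_iff]
    refine and_congr_right fun _ => ⟨fun hs u hu => hs u (by omega), fun hs u hu k hk => ?_⟩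
    rcases Nat.lt_succ_iff_lt_or_eq.1 hu with hlt | heq
    · exact hs u hlt k hk
    · have : s t k = false := by
        by_contra hc
        exact h ⟨k, hk, by simpa using hc⟩
      rw [Fin.ext heq]
      simp [output, this]

variable {δ : ℕ → ℝ}

lemma expect_ent_view_succ (t : Fin n) :
    expect δ (fun s => ent (view enc b U s (t + 1))) = expect δ (fun s => ent (view enc b U s t)) +
      linkMean (δ t) (fun a => if ∃ k ∈ U, a k then 1 else 0) *
        expect δ (fun s => inputEnt enc b U s t) := by
  simp only [ent_view_succ]
  rw [expect_add, expect_mul_of_indep t (fun a => if ∃ k ∈ U, a k then (1 : ℝ) else 0)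
    (fun s => inputEnt enc b U s t) (fun s a => inputEnt_update enc b U s t a)]
  rfl

variable (h0 : ∀ t, 0 ≤ δ t) (h1 : ∀ t, δ t ≤ 1)

include h0 h1

lemma expect_ent_view_single_le (i : Fin 2) :
    expect δ (fun s => ent (view enc b {i} s n)) ≤
      expect δ (fun s => ent (view enc b {i} s 0)) +
        (∑ t ∈ Finset.range n, (1 - δ t)) * Real.log 2 := by
  have key : ∀ t ≤ n, expect δ (fun s => ent (view enc b {i} s t)) ≤
      expect δ (fun s => ent (view enc b {i} s 0)) +
        (∑ u ∈ Finset.range t, (1 - δ u)) * Real.log 2 := by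
    intro t
    induction t with
    | zero => simp
    | succ t ih =>
      intro ht
      have h := expect_ent_view_succ (δ := δ) enc b {i} ⟨t, ht⟩
      have hc : expect δ (fun s => inputEnt enc b {i} s ⟨t, ht⟩) ≤ Real.log 2 :=
        (expect_mono h0 h1 fun s => inputEnt_le enc b {i} s _).trans_eq (expect_const _)
      rw [linkMean_single] at h
      rw [Finset.sum_range_succ, add_mul]
      have := mul_le_mul_of_nonneg_left hc (sub_nonneg.2 (h1 t))
      have := ih (by omega)
      simp only at h
      linarith
  exact key n le_rfl

open Classical in
/-- Entropy leakage: with delayed state feedback, the joint entropy of both outputs is at most `β`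
times that of a single output, up to the channel uses with erasure probability above `β - 1`. -/
lemma expect_ent_view_univ_le (i : Fin 2) {β : ℝ} :
    expect δ (fun s => ent (view enc b Finset.univ s n)) -
        expect δ (fun s => ent (view enc b Finset.univ s 0)) ≤
      β * (expect δ (fun s => ent (view enc b {i} s n)) -
        expect δ (fun s => ent (view enc b {i} s 0))) +
        (∑ t ∈ Finset.range n, if 1 + δ t ≤ β then 0 else 1) *
          (|β| + 1) * Real.log 2 := by
  have key : ∀ t ≤ n, expect δ (fun s => ent (view enc b Finset.univ s t)) -
        expect δ (fun s => ent (view enc b Finset.univ s 0)) ≤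
      β * (expect δ (fun s => ent (view enc b {i} s t)) -
        expect δ (fun s => ent (view enc b {i} s 0))) +
        (∑ t ∈ Finset.range t, if 1 + δ t ≤ β then 0 else 1) *
          (|β| + 1) * Real.log 2 := by
    intro t
    induction t with
    | zero => simp
    | succ t ih =>
      intro ht
      have hs := expect_ent_view_succ (δ := δ) enc b {i} ⟨t, ht⟩
      have hu := expect_ent_view_succ (δ := δ) enc b Finset.univ ⟨t, ht⟩
      rw [linkMean_single] at hs
      rw [linkMean_univ] at hu
      simp only at hs hu
      set x := expect δ (fun s => inputEnt enc b {i} s ⟨t, ht⟩)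
      set y := expect δ (fun s => inputEnt enc b Finset.univ s ⟨t, ht⟩)
      have hy0 : 0 ≤ y := by
        rw [← expect_const (n := n) (δ := δ) 0]
        exact expect_mono h0 h1 fun s => inputEnt_nonneg enc b _ s _
      have hxl : x ≤ Real.log 2 :=
        (expect_mono h0 h1 fun s => inputEnt_le enc b {i} s _).trans_eq (expect_const _)
      have hyx : y ≤ x :=
        expect_mono h0 h1 fun s => inputEnt_anti enc b (Finset.subset_univ _) s _
      have ih := ih (by omega)
      rw [Finset.sum_range_succ, add_mul, add_mul, hs, hu]
      have hd0 := h0 t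
      have hd1 := h1 t
      -- An ordinary use is handled by 1 - δ² = (1 + δ)(1 - δ) and `y ≤ x`. An exceptional one is
      -- bounded crudely: the left side costs at most log 2, and `β * ((1 - δ t) * x)` is at least
      -- -|β| log 2.
      have step : (1 - δ t ^ 2) * y ≤ β * ((1 - δ t) * x) +
          (if 1 + δ t ≤ β then 0 else 1) * (|β| + 1) * Real.log 2 := by
        split_ifs with hβ
        · have e1 : (1 - δ t ^ 2) * y = (1 + δ t) * ((1 - δ t) * y) := by ring
          have e2 : (1 - δ t) * y ≤ (1 - δ t) * x :=
            mul_le_mul_of_nonneg_left hyx (by linarith)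
          have e3 : 0 ≤ (1 - δ t) * y := mul_nonneg (by linarith) hy0
          rw [e1, zero_mul, zero_mul, add_zero]
          exact mul_le_mul hβ e2 e3 (by linarith)
        · have e1 : (1 - δ t ^ 2) * y ≤ 1 * Real.log 2 :=
            mul_le_mul (by nlinarith) (by linarith) hy0 zero_le_one
          have e2 : -(β * ((1 - δ t) * x)) ≤ |β| * Real.log 2 := by
            rw [← neg_mul]
            refine mul_le_mul (neg_le_abs β) ?_ (mul_nonneg (by linarith) (by linarith))
              (abs_nonneg _)
            nlinarith
          linarith
      linarith
  exact key n le_rfl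

end

section

variable {n : ℕ} {m : Fin 2 → ℕ} {γ : Type*} (enc : Encoder n m)

lemma ent_injective {Ω α : Type*} [Fintype Ω] [Nonempty Ω] {f : Ω → α}
    (hf : Function.Injective f) : ent f = Real.log (Fintype.card Ω) := by
  rw [ent_of_fiberCard (c := 1), div_one]
  intro w
  rw [fiberCard, Finset.card_eq_one.2 ⟨w, by ext v; simp [hf.eq_iff]⟩, Nat.cast_one]

lemma log_card_word (k : ℕ) : Real.log (Fintype.card (Fin k → ZMod 2)) = k * Real.log 2 := by
  simp [ZMod.card]

lemma log_card_messages {i j : Fin 2} (hij : i ≠ j) :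
    Real.log (Fintype.card (Messages m)) = (m i + m j) * Real.log 2 := by
  rw [Fintype.card_pi]
  push_cast
  rw [Real.log_prod (by intro k _; simp [ZMod.card]), Fin.sum_univ_two, log_card_word,
    log_card_word]
  fin_cases i <;> fin_cases j <;> simp at hij ⊢ <;> ring

lemma messages_ext {i j : Fin 2} (hij : i ≠ j) {v w : Messages m} (hi : v i = w i)
    (hj : v j = w j) : v = w := by
  ext1 k
  obtain rfl | rfl : k = i ∨ k = j := by
    revert hij; clear hi hj; revert i j k; decide
  · exact hi
  · exact hj

/-- The cardinality bounds for the first message and for the second given the first add up to the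
entropy of the pair, so both are equalities. -/
lemma ent_message (i : Fin 2) : ent (fun w : Messages m => w i) = m i * Real.log 2 := by
  obtain ⟨j, hij⟩ : ∃ j : Fin 2, i ≠ j := by revert i; decide
  have e1 : ent (fun w : Messages m => ((), w i)) = ent (fun w : Messages m => w i) :=
    ent_congr fun v w => by simp
  have e2 : ent (fun _ : Messages m => ()) = 0 := by
    rw [ent_of_fiberCard (c := Fintype.card (Messages m))]
    · simp
    · intro w
      simp [fiberCard]
  have h1 := ent_pair_sub_le_log_card (fun _ : Messages m => ()) (fun w => w i)
  have h2 := ent_pair_sub_le_log_card (fun w : Messages m => w i) (fun w => w j)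
  rw [ent_injective (fun v w h => messages_ext hij (Prod.mk.inj h).1 (Prod.mk.inj h).2),
    log_card_messages hij, log_card_word] at h2
  rw [e1, e2, log_card_word] at h1
  linarith

lemma errorProb_eq_expect {δ : ℕ → ℝ} (i : Fin 2) (dec : Decoder n (m i)) :
    errorProb δ enc i dec = expect δ (fun s =>
      (∑ w, if dec (output enc w s i) s ≠ w i then 1 else 0) / Fintype.card (Messages m)) := by
  simp only [errorProb, expect, ← mul_div_assoc, ← Finset.sum_div, Finset.mul_sum]
  rw [Finset.sum_comm]
  congr 1
  refine Finset.sum_congr rfl fun s _ => Finset.sum_congr rfl fun w _ => ?_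
  split_ifs <;> simp

lemma expect_fano {δ : ℕ → ℝ} (h0 : ∀ t, 0 ≤ δ t) (h1 : ∀ t, δ t ≤ 1)
    (b : Messages m → γ) {U : Finset (Fin 2)} {i : Fin 2} (hi : i ∈ U)
    (dec : Decoder n (m i)) :
    expect δ (fun s => ent (fun w => (view enc b U s n w, w i))) -
        expect δ (fun s => ent (view enc b U s n)) ≤
      Real.log 2 + errorProb δ enc i dec * (m i * Real.log 2) := by
  rw [← expect_sub, errorProb_eq_expect, mul_comm (expect _ _), ← expect_mul_left,
    ← expect_const (n := n) (δ := δ) (Real.log 2), ← expect_add, expect_const]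
  refine expect_mono h0 h1 fun s => ?_
  -- At time `n` the coordinate of a user in `U` is unmasked, so the decoder can be run on the view.
  have h := ent_pair_sub_le_fano (view enc b U s n) (fun w => w i)
    (fun a => dec (fun u => a.2 u i) s)
  have hv : ∀ w, (fun u => (view enc b U s n w).2 u i) = output enc w s i := by
    intro w
    ext1 u
    simp [view, hi]
  simp only [hv] at h
  rw [log_card_word] at h
  rwa [mul_comm (_ / _ : ℝ)] at h

open Classical in
/-- The outer bound at blocklength `n`. -/
lemma converse_bound {δ : ℕ → ℝ} (h0 : ∀ t, 0 ≤ δ t) (h1 : ∀ t, δ t ≤ 1) {i j : Fin 2}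
    (hij : i ≠ j) {β : ℝ} (hβ : 0 ≤ β) (deci : Decoder n (m i)) (decj : Decoder n (m j)) :
    β * (m i * (1 - errorProb δ enc i deci)) + m j * (1 - errorProb δ enc j decj) ≤
      β * ∑ t ∈ Finset.range n, (1 - δ t) + (β + 1) +
        (β + 1) * ∑ t ∈ Finset.range n, if 1 + δ t ≤ β then 0 else 1 := by
  have hL : 0 < Real.log 2 := Real.log_pos one_lt_two
  have hz : ∀ U, expect (n := n) δ (fun s => ent (view enc (fun w => w i) U s 0)) =
      m i * Real.log 2 := by
    intro U
    rw [← ent_message, ← expect_const (n := n) (δ := δ) (ent _)]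
    congr 1
    ext s
    refine ent_congr fun v w => ?_
    simp [view_eq_iff]
  have hc : expect (n := n) δ (fun s => ent (view enc (fun _ => ()) {i} s 0)) = 0 := by
    rw [← expect_const (n := n) (δ := δ) 0]
    congr 1
    ext s
    rw [ent_of_fiberCard (c := Fintype.card (Messages m))]
    · simp
    · intro w
      simp [fiberCard, view_eq_iff]
  -- User i is treated without side information, to bound H(Yᵢ) and decode Wᵢ. The pair of outputs
  -- is treated given Wᵢ, to compare it with Yᵢ and decode Wⱼ.
  have a1 := expect_ent_view_single_le enc (fun _ => ()) h0 h1 i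
  have a2 := expect_ent_view_univ_le enc (fun w => w i) h0 h1 i (β := β)
  have a3 := expect_fano enc h0 h1 (fun _ => ()) (Finset.mem_singleton_self i) deci
  have a4 := expect_fano enc h0 h1 (fun w => w i) (Finset.mem_univ j) decj
  have e3 : ∀ s, ent (fun w => (view enc (fun _ => ()) {i} s n w, w i)) =
      ent (view enc (fun w => w i) {i} s n) := by
    intro s
    refine ent_congr fun v w => ?_
    simp only [Prod.mk.injEq, view_eq_iff, true_and]
    exact and_comm
  have e4 : ∀ s, ent (fun w => (view enc (fun w => w i) Finset.univ s n w, w j)) =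
      (m i + m j) * Real.log 2 := by
    intro s
    rw [← log_card_messages hij]
    refine ent_injective fun v w h => ?_
    simp only [Prod.mk.injEq, view_eq_iff] at h
    exact messages_ext hij h.1.1 h.2
  simp only [e3] at a3
  simp only [e4, expect_const] at a4
  rw [hc] at a1
  rw [hz, hz, abs_of_nonneg hβ] at a2
  have a5 := mul_le_mul_of_nonneg_left (a3.trans' (sub_le_sub_left a1 _)) hβ
  rw [← mul_le_mul_iff_left₀ hL]
  linarith

end

/-! ### The coding scheme

A channel use is dedicated to user `i` (`some i`) or joint (`none`).  For each user, the transmitter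
keeps a queue of fresh packets, received by nobody so far, and a queue of overheard packets,
received by the other user only. In a dedicated channel use it sends the first fresh packet, in a
joint channel use the sum of the first overheard packets of both users. -/

/-- The queues of fresh and of overheard packets of one user. -/
abbrev Queues (k : ℕ) : Type := List (Fin k) × List (Fin k)

/-- The update of the queues of user `i`, given the feedback `a`. -/
def Queues.step {k : ℕ} (i : Fin 2) (τ : Option (Fin 2)) (a : Fin 2 → Bool) (q : Queues k) :
    Queues k :=
  if τ = none then
    if a i then (q.1, q.2.tail) else q
  else if τ = some i then
    match q.1 with
    | [] => q
    | p :: r => if a i then (r, q.2) else if a (1 - i) then (r, p :: q.2) else q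
  else q

/-- The first packet of a queue, and `0` if there is none. -/
def headPacket {k : ℕ} (x : Fin k → ZMod 2) : List (Fin k) → ZMod 2
  | [] => 0
  | p :: _ => x p

/-- The summand of user `i` in the channel input. -/
def Queues.summand {k : ℕ} (i : Fin 2) (τ : Option (Fin 2)) (q : Queues k) (x : Fin k → ZMod 2) :
    ZMod 2 :=
  if τ = none then headPacket x q.2 else if τ = some i then headPacket x q.1 else 0

/-- The queues of user `i` after `t` channel uses. -/
def queues (τ : ℕ → Option (Fin 2)) (k : ℕ) (i : Fin 2) (σ : ℕ → Fin 2 → Bool) : ℕ → Queues k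
  | 0 => (List.finRange k, [])
  | t + 1 => Queues.step i (τ t) (σ t) (queues τ k i σ t)

/-- Finitely many states, continued by erasures. -/
def extendStates {k : ℕ} (s : States k) (t : ℕ) : Fin 2 → Bool :=
  if h : t < k then s ⟨t, h⟩ else fun _ => false

/-- The encoder of the queueing scheme. -/
def queueEncoder (τ : ℕ → Option (Fin 2)) (n : ℕ) (m : Fin 2 → ℕ) : Encoder n m :=
  fun t w s => ∑ i, (queues τ (m i) i (extendStates s) t).summand i (τ t) (w i)

lemma queues_congr {τ : ℕ → Option (Fin 2)} {k : ℕ} {i : Fin 2} {σ σ' : ℕ → Fin 2 → Bool} {t : ℕ}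
    (h : ∀ u < t, σ u = σ' u) : queues τ k i σ t = queues τ k i σ' t := by
  induction t with
  | zero => rfl
  | succ t ih => rw [queues, queues, ih fun u hu => h u (by omega), h t (by omega)]

/-- The queues before use `t` depend on earlier states only, so the erasures padded on by
`extendStates` are never read, and the full state sequence may replace the past. -/
lemma queueEncoder_pastStates (τ : ℕ → Option (Fin 2)) {n : ℕ} {m : Fin 2 → ℕ} (t : Fin n)
    (w : Messages m) (s : States n) {i j : Fin 2} (hij : i ≠ j) :
    queueEncoder τ n m t w (pastStates s t) =
      (queues τ (m i) i (extendStates s) t).summand i (τ t) (w i) +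
        (queues τ (m j) j (extendStates s) t).summand j (τ t) (w j) := by
  have h : ∀ k i, queues τ k i (extendStates (pastStates s t)) t =
      queues τ k i (extendStates s) t := by
    intro k i
    refine queues_congr fun u hu => ?_
    simp [extendStates, hu, hu.trans t.isLt, pastStates]
  simp only [queueEncoder, h, Fin.sum_univ_two]
  fin_cases i <;> fin_cases j <;> simp at hij ⊢
  exact add_comm _ _

lemma extendStates_val {n : ℕ} (s : States n) (t : Fin n) : extendStates s t = s t := by
  simp [extendStates]

/-- Every user knows its packets that are in no queue, and the overheard packets of the other
user. -/
lemma queues_known (τ : ℕ → Option (Fin 2)) {n : ℕ} {m : Fin 2 → ℕ} (s : States n)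
    {i j : Fin 2} (hij : i ≠ j) {v w : Messages m}
    (h : output (queueEncoder τ n m) v s i = output (queueEncoder τ n m) w s i) {t : ℕ}
    (ht : t ≤ n) :
    (∀ p, p ∈ (queues τ (m i) i (extendStates s) t).1 ∨
        p ∈ (queues τ (m i) i (extendStates s) t).2 ∨ v i p = w i p) ∧
      ∀ p ∈ (queues τ (m j) j (extendStates s) t).2, v j p = w j p := by
  induction t with
  | zero => simp [queues]
  | succ t ih =>
    obtain ⟨ih1, ih2⟩ := ih (by omega)
    have hout := congrFun h ⟨t, ht⟩
    rw [output, output, queueEncoder_pastStates τ _ _ _ hij,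
      queueEncoder_pastStates τ _ _ _ hij, ← extendStates_val s ⟨t, ht⟩] at hout
    simp only [queues] at hout ⊢
    have hji : 1 - j = i := by revert hij; clear * -; revert i j; decide
    generalize queues τ (m i) i (extendStates s) t = q at *
    generalize queues τ (m j) j (extendStates s) t = r at *
    generalize extendStates s t = a at *
    obtain ⟨q1, q2⟩ := q
    obtain ⟨r1, r2⟩ := r
    rcases hτ : τ t with _ | k
    -- Joint use: user i overheard the other user's head packet earlier, hence cancels it and
    -- obtains its own.
    · simp only [hτ, Queues.summand, if_true] at hout
      simp only [Queues.step, if_true]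
      constructor
      · intro p
        split_ifs with ha
        · rw [if_pos ha, if_pos ha] at hout
          have hr : headPacket (v j) r2 = headPacket (w j) r2 := by
            cases r2 with
            | nil => rfl
            | cons p r => exact ih2 p (by simp)
          rw [hr, add_left_inj] at hout
          cases q2 with
          | nil => simpa using ih1 p
          | cons p' q =>
            rcases ih1 p with h1 | h1 | h1
            · exact Or.inl h1
            · rcases List.mem_cons.1 h1 with rfl | h2
              · exact Or.inr (Or.inr hout)
              · exact Or.inr (Or.inl h2)
            · exact Or.inr (Or.inr h1)
        · exact ih1 p
      · intro p hp
        split_ifs at hp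
        · exact ih2 p (List.mem_of_mem_tail hp)
        · exact ih2 p hp
    · obtain rfl | rfl : k = i ∨ k = j := by
        revert hij; clear * -; revert i j k; decide
      · have hne : some k ≠ some j := fun h => hij (Option.some.inj h)
        simp only [hτ, Queues.summand, reduceCtorEq, if_false, if_true, if_neg hne,
          add_zero] at hout
        simp only [Queues.step, reduceCtorEq, if_false, if_true, if_neg hne]
        refine ⟨fun p => ?_, ih2⟩
        cases q1 with
        | nil => exact ih1 p
        | cons p' q =>
          simp only
          split_ifs with h1 h2
          · rw [if_pos h1, if_pos h1] at hout
            rcases ih1 p with h3 | h3 | h3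
            · rcases List.mem_cons.1 h3 with rfl | h4
              · exact Or.inr (Or.inr hout)
              · exact Or.inl h4
            · exact Or.inr (Or.inl h3)
            · exact Or.inr (Or.inr h3)
          · rcases ih1 p with h3 | h3 | h3
            · rcases List.mem_cons.1 h3 with rfl | h4
              · exact Or.inr (Or.inl (by simp))
              · exact Or.inl h4
            · exact Or.inr (Or.inl (List.mem_cons_of_mem _ h3))
            · exact Or.inr (Or.inr h3)
          · exact ih1 p
      -- Use dedicated to the other user: a packet enters that user's overheard queue only when user
      -- i has just received it uncoded.
      · have hne : some k ≠ some i := fun h => hij (Option.some.inj h).symm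
        simp only [hτ, Queues.summand, reduceCtorEq, if_false, if_true, if_neg hne,
          zero_add] at hout
        simp only [Queues.step, reduceCtorEq, if_false, if_true, if_neg hne]
        refine ⟨ih1, fun p hp => ?_⟩
        cases r1 with
        | nil => exact ih2 p hp
        | cons p' r =>
          simp only at hp
          split_ifs at hp with h1 h2
          · exact ih2 p hp
          · rw [hji] at h2
            rw [if_pos h2, if_pos h2] at hout
            rcases List.mem_cons.1 hp with rfl | h4
            · exact hout
            · exact ih2 p h4
          · exact ih2 p hp

/-- Whether a fresh packet of user `i` gets through to someone. -/
def freshServed (i : Fin 2) (τ : Option (Fin 2)) (a : Fin 2 → Bool) : ℕ :=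
  if τ = some i ∧ (a i ∨ a (1 - i)) then 1 else 0

/-- Whether a fresh packet of user `i` is overheard. -/
def overhearing (i : Fin 2) (τ : Option (Fin 2)) (a : Fin 2 → Bool) : ℕ :=
  if τ = some i ∧ ¬ a i ∧ a (1 - i) then 1 else 0

/-- Whether an overheard packet of user `i` is delivered. -/
def overheardServed (i : Fin 2) (τ : Option (Fin 2)) (a : Fin 2 → Bool) : ℕ :=
  if τ = none ∧ a i then 1 else 0

/-- `freshServed` also counts uses in which the queue is already empty; truncated subtraction
absorbs them, which keeps this an equality. -/
lemma length_fresh (τ : ℕ → Option (Fin 2)) (k : ℕ) (i : Fin 2) (σ : ℕ → Fin 2 → Bool) (t : ℕ) :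
    (queues τ k i σ t).1.length = k - ∑ u ∈ Finset.range t, freshServed i (τ u) (σ u) := by
  induction t with
  | zero => simp [queues]
  | succ t ih =>
    rw [Finset.sum_range_succ, Nat.sub_add_eq, ← ih, queues]
    generalize queues τ k i σ t = q
    obtain ⟨q1, q2⟩ := q
    simp only [Queues.step, freshServed]
    rcases τ t with _ | j
    · simp only [if_true, reduceCtorEq, false_and, if_false]
      split_ifs <;> rfl
    · by_cases hj : j = i
      · subst hj
        cases q1 with
        | nil => simp
        | cons p r =>
          cases σ t j <;> cases σ t (1 - j) <;> simp
      · simp [hj]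

/-- Because joint uses come last, all arrivals precede all services, so no service is wasted before
a later arrival. Only an inequality holds, since `overhearing` also counts uses with no fresh packet
left. -/
lemma length_overheard_le {τ : ℕ → Option (Fin 2)}
    (hτ : ∀ t u, t ≤ u → τ t = none → τ u = none) (k : ℕ) (i : Fin 2)
    (σ : ℕ → Fin 2 → Bool) (t : ℕ) :
    (queues τ k i σ t).2.length ≤ ∑ u ∈ Finset.range t, overhearing i (τ u) (σ u) -
      ∑ u ∈ Finset.range t, overheardServed i (τ u) (σ u) := by
  induction t with
  | zero => simp [queues]
  | succ t ih =>
    rw [Finset.sum_range_succ, Finset.sum_range_succ, queues]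
    have hnone : τ t ≠ none → ∑ u ∈ Finset.range t, overheardServed i (τ u) (σ u) = 0 := by
      intro h
      refine Finset.sum_eq_zero fun u hu => ?_
      have : τ u ≠ none := fun hc => h (hτ u t (Finset.mem_range.1 hu).le hc)
      simp [overheardServed, this]
    generalize ∑ u ∈ Finset.range t, overhearing i (τ u) (σ u) = B at *
    generalize ∑ u ∈ Finset.range t, overheardServed i (τ u) (σ u) = A at *
    generalize queues τ k i σ t = q at *
    obtain ⟨q1, q2⟩ := q
    simp only [Queues.step, overhearing, overheardServed] at *
    generalize τ t = c at *
    rcases c with _ | j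
    · cases σ t i <;> simp <;> omega
    · have hA := hnone (by simp)
      subst hA
      by_cases hj : j = i
      · subst hj
        cases q1 with
        | nil => simp at *; omega
        | cons p r =>
          cases σ t j <;> cases σ t (1 - j) <;> simp at * <;> omega
      · simpa [hj] using ih

open Classical in
/-- A decoder for user `i` which looks for a message pair consistent with the observations. -/
def consistentDecoder {n : ℕ} {m : Fin 2 → ℕ} (enc : Encoder n m) (i : Fin 2) :
    Decoder n (m i) := fun y s =>
  if h : ∃ w, output enc w s i = y then h.choose i else 0

/-- Under these counts both queues of user i end empty, so by `queues_known` all message pairs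
consistent with its observations share the true i-th message. -/
lemma consistentDecoder_eq {τ : ℕ → Option (Fin 2)}
    (hτ : ∀ t u, t ≤ u → τ t = none → τ u = none) {n : ℕ} {m : Fin 2 → ℕ} (s : States n)
    (i : Fin 2) (w : Messages m)
    (hf : m i ≤ ∑ t : Fin n, freshServed i (τ t) (s t))
    (ho : ∑ t : Fin n, overhearing i (τ t) (s t) ≤ ∑ t : Fin n, overheardServed i (τ t) (s t)) :
    consistentDecoder (queueEncoder τ n m) i (output (queueEncoder τ n m) w s i) s = w i := by
  have hex : ∃ v, output (queueEncoder τ n m) v s i = output (queueEncoder τ n m) w s i := ⟨w, rfl⟩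
  rw [consistentDecoder, dif_pos hex]
  obtain ⟨j, hij⟩ : ∃ j : Fin 2, i ≠ j := by clear * -; revert i; decide
  have hsum : ∀ F : Option (Fin 2) → (Fin 2 → Bool) → ℕ, ∑ t : Fin n, F (τ t) (s t) =
      ∑ t ∈ Finset.range n, F (τ t) (extendStates s t) := by
    intro F
    rw [← Fin.sum_univ_eq_sum_range (fun t => F (τ t) (extendStates s t))]
    simp only [extendStates_val]
  rw [hsum] at hf
  rw [hsum, hsum] at ho
  have h1 := length_fresh τ (m i) i (extendStates s) n
  have h2 := length_overheard_le hτ (m i) i (extendStates s) n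
  rw [Nat.sub_eq_zero_of_le hf, List.length_eq_zero_iff] at h1
  rw [Nat.sub_eq_zero_of_le ho, Nat.le_zero, List.length_eq_zero_iff] at h2
  have h3 := (queues_known τ s hij hex.choose_spec le_rfl).1
  rw [h1, h2] at h3
  ext1 p
  simpa using h3 p

lemma linkMean_freshServed (p : ℝ) (i : Fin 2) (c : Option (Fin 2)) :
    linkMean p (fun a => (freshServed i c a : ℝ)) = if c = some i then 1 - p ^ 2 else 0 := by
  rw [linkMean, sum_link]
  by_cases hc : c = some i
  · fin_cases i <;> simp [freshServed, linkProb, Fin.prod_univ_two, hc] <;> ring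
  · simp [freshServed, hc]

lemma linkMean_overhearing (p : ℝ) (i : Fin 2) (c : Option (Fin 2)) :
    linkMean p (fun a => (overhearing i c a : ℝ)) = if c = some i then p * (1 - p) else 0 := by
  rw [linkMean, sum_link]
  by_cases hc : c = some i
  · fin_cases i <;> simp [overhearing, linkProb, Fin.prod_univ_two, hc]
    ring
  · simp [overhearing, hc]

lemma linkMean_overheardServed (p : ℝ) (i : Fin 2) (c : Option (Fin 2)) :
    linkMean p (fun a => (overheardServed i c a : ℝ)) = if c = none then 1 - p else 0 := by
  rw [linkMean, sum_link]
  by_cases hc : c = none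
  · fin_cases i <;> (simp [overheardServed, linkProb, Fin.prod_univ_two, hc]; ring)
  · simp [overheardServed, hc]

lemma errorProb_nonneg {n : ℕ} {m : Fin 2 → ℕ} {δ : ℕ → ℝ} (h0 : ∀ t, 0 ≤ δ t)
    (h1 : ∀ t, δ t ≤ 1) (enc : Encoder n m) (i : Fin 2) (dec : Decoder n (m i)) :
    0 ≤ errorProb δ enc i dec := by
  refine div_nonneg (Finset.sum_nonneg fun w _ => Finset.sum_nonneg fun s _ => ?_)
    (Nat.cast_nonneg _)
  split_ifs
  · exact stateProb_nonneg h0 h1 s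
  · exact le_rfl

/-- The error probability of the queueing scheme when its mean drifts have a margin of `g`. -/
lemma errorProb_queueEncoder_le {n : ℕ} {m : Fin 2 → ℕ} {δ : ℕ → ℝ} (h0 : ∀ t, 0 ≤ δ t)
    (h1 : ∀ t, δ t ≤ 1) {τ : ℕ → Option (Fin 2)}
    (hτ : ∀ t u, t ≤ u → τ t = none → τ u = none) (i : Fin 2) {g : ℝ} (hg : 0 < g)
    (hf : m i + g ≤ ∑ t ∈ Finset.range n, if τ t = some i then 1 - δ t ^ 2 else 0)
    (ho : (∑ t ∈ Finset.range n, if τ t = some i then δ t * (1 - δ t) else 0) + 2 * g ≤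
      ∑ t ∈ Finset.range n, if τ t = none then 1 - δ t else 0) :
    errorProb δ (queueEncoder τ n m) i (consistentDecoder (queueEncoder τ n m) i) ≤
      3 * (n / g ^ 2) := by
  classical
  rw [← Fin.sum_univ_eq_sum_range (fun t => if τ t = some i then 1 - δ t ^ 2 else 0)] at hf
  rw [← Fin.sum_univ_eq_sum_range (fun t => if τ t = some i then δ t * (1 - δ t) else 0),
    ← Fin.sum_univ_eq_sum_range (fun t => if τ t = none then 1 - δ t else 0)] at ho
  simp only [← linkMean_freshServed, ← linkMean_overhearing,
    ← linkMean_overheardServed _ i] at hf ho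
  let dev (F : Fin 2 → Option (Fin 2) → (Fin 2 → Bool) → ℕ) (s : States n) : ℝ :=
    if g ≤ |∑ t : Fin n, (F i (τ t) (s t) : ℝ) -
      ∑ t : Fin n, linkMean (δ t) (fun a => (F i (τ t) a : ℝ))| then 1 else 0
  have hdev : ∀ F : Fin 2 → Option (Fin 2) → (Fin 2 → Bool) → ℕ,
      (∀ j c a, F j c a ≤ 1) → expect δ (dev F) ≤ n / g ^ 2 := by
    intro F hF
    exact expect_deviation_le h0 h1 (fun t a => (F i (τ t) a : ℝ))
      (fun t a => ⟨Nat.cast_nonneg _, by exact_mod_cast hF i (τ t) a⟩) hg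
  have hdev0 : ∀ F s, 0 ≤ dev F s := by
    intro F s
    simp only [dev]
    split_ifs <;> norm_num
  have d1 := hdev freshServed (fun j c a => by unfold freshServed; split_ifs <;> simp)
  have d2 := hdev overhearing (fun j c a => by unfold overhearing; split_ifs <;> simp)
  have d3 := hdev overheardServed (fun j c a => by unfold overheardServed; split_ifs <;> simp)
  rw [errorProb_eq_expect]
  refine le_trans (expect_mono h0 h1
    (ψ := fun s => dev freshServed s + dev overhearing s + dev overheardServed s) fun s => ?_) ?_
  · have n1 := hdev0 freshServed s
    have n2 := hdev0 overhearing s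
    have n3 := hdev0 overheardServed s
    have hcard : (0 : ℝ) < Fintype.card (Messages m) := by exact_mod_cast Fintype.card_pos
    by_cases hgood : m i ≤ ∑ t : Fin n, freshServed i (τ t) (s t) ∧
        ∑ t : Fin n, overhearing i (τ t) (s t) ≤ ∑ t : Fin n, overheardServed i (τ t) (s t)
    · simp only [consistentDecoder_eq hτ s i _ hgood.1 hgood.2, ne_eq, not_true_eq_false,
        if_false, Finset.sum_const_zero, zero_div]
      linarith
    · have hle : (∑ w, if consistentDecoder (queueEncoder τ n m) i
          (output (queueEncoder τ n m) w s i) s ≠ w i then (1 : ℝ) else 0) /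
            Fintype.card (Messages m) ≤ 1 := by
        rw [div_le_one hcard, Fintype.card_eq_sum_ones, Nat.cast_sum]
        refine Finset.sum_le_sum fun w _ => ?_
        split_ifs <;> simp
      refine hle.trans ?_
      -- If none of the three sums deviates by `g`, the margins force the good event: one `g` covers
      -- the fresh count, and `2 * g` covers the two sums compared for the overheard queue.
      by_contra! hlt
      have small : ∀ F, dev F s < 1 → |∑ t : Fin n, (F i (τ t) (s t) : ℝ) -
          ∑ t : Fin n, linkMean (δ t) (fun a => (F i (τ t) a : ℝ))| < g := by
        intro F h
        by_contra! hc
        simp [dev, hc] at h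
      have s1 := abs_lt.1 (small freshServed (by linarith))
      have s2 := abs_lt.1 (small overhearing (by linarith))
      have s3 := abs_lt.1 (small overheardServed (by linarith))
      refine hgood ⟨?_, ?_⟩
      · have : (m i : ℝ) ≤ ∑ t : Fin n, (freshServed i (τ t) (s t) : ℝ) := by linarith
        exact_mod_cast this
      · have : ∑ t : Fin n, (overhearing i (τ t) (s t) : ℝ) ≤
            ∑ t : Fin n, (overheardServed i (τ t) (s t) : ℝ) := by linarith
        exact_mod_cast this
  · rw [expect_add, expect_add]
    linarith

/-! ### The two-phase schedule and its sums over the modes -/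

/-- The schedule which dedicates the first `a` channel uses to user `0`, the next `b` ones to user
`1`, and makes all others joint. -/
def schedule (a b t : ℕ) : Option (Fin 2) :=
  if t < a then some 0 else if t < a + b then some 1 else none

lemma schedule_none {a b t u : ℕ} (h : t ≤ u) (ht : schedule a b t = none) :
    schedule a b u = none := by
  unfold schedule at *
  split_ifs at * <;> first | rfl | omega

lemma sum_range_eq_sum_Ico {F : ℕ → ℝ} {k l n : ℕ} (h : k + l ≤ n) :
    ∑ t ∈ Finset.range n, F t = ∑ t ∈ Finset.Ico 0 k, F t + ∑ t ∈ Finset.Ico k (k + l), F t +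
      ∑ t ∈ Finset.Ico (k + l) n, F t := by
  rw [Finset.sum_Ico_consecutive _ (by omega) (by omega),
    Finset.sum_Ico_consecutive _ (by omega) h, Finset.range_eq_Ico]

lemma sum_Ico_of_eq {F : ℕ → ℝ} {k l : ℕ} (h : k ≤ l) {c : ℝ}
    (hF : ∀ t, k ≤ t → t < l → F t = c) : ∑ t ∈ Finset.Ico k l, F t = (l - k) * c := by
  rw [Finset.sum_congr rfl fun t ht => hF t (Finset.mem_Ico.1 ht).1 (Finset.mem_Ico.1 ht).2]
  simp [Nat.cast_sub h]

lemma sum_schedule_some {L : Fin 2 → ℕ} {n : ℕ} (h : L 0 + L 1 ≤ n) (i : Fin 2) {F : ℕ → ℝ}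
    {c : ℝ} (hF : ∀ t < L 0 + L 1, F t = c) :
    (∑ t ∈ Finset.range n, if schedule (L 0) (L 1) t = some i then F t else 0) = L i * c := by
  rw [sum_range_eq_sum_Ico h,
    sum_Ico_of_eq (c := if i = 0 then c else 0) (by omega),
    sum_Ico_of_eq (c := if i = 1 then c else 0) (by omega), sum_Ico_of_eq (c := 0) h]
  · push_cast
    fin_cases i <;> simp
  · intro t h1 h2
    simp [schedule, show ¬ t < L 0 by omega, show ¬ t < L 0 + L 1 by omega]
  · intro t h1 h2
    simp [schedule, show ¬ t < L 0 by omega, h2, hF t h2, eq_comm]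
  · intro t h1 h2
    simp [schedule, h2, hF t (by omega), eq_comm]

section

variable {δA δT δB : ℝ} {a b n : ℕ}

lemma erasureProb_nonneg (hA : 0 ≤ δA) (hT : 0 ≤ δT) (hB : 0 ≤ δB) (t : ℕ) :
    0 ≤ erasureProb δA δT δB a b t := by
  unfold erasureProb; split_ifs <;> assumption

lemma erasureProb_le_one (hA : δA ≤ 1) (hT : δT ≤ 1) (hB : δB ≤ 1) (t : ℕ) :
    erasureProb δA δT δB a b t ≤ 1 := by
  unfold erasureProb; split_ifs <;> assumption

/-- Deliveries in the transient mode are nonnegative and simply dropped, leaving a bound free of δT.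
-/
lemma le_sum_schedule_none (hT : δT ≤ 1) {k l : ℕ} (h : k + l ≤ a) (hab : a + b ≤ n) :
    (a - (k + l)) * (1 - δA) + (n - (a + b)) * (1 - δB) ≤
      ∑ t ∈ Finset.range n,
        if schedule k l t = none then 1 - erasureProb δA δT δB a b t else 0 := by
  rw [sum_range_eq_sum_Ico hab, ← Finset.sum_Ico_consecutive _ (Nat.zero_le (k + l)) h,
    sum_Ico_of_eq (c := 0) (Nat.zero_le (k + l)), sum_Ico_of_eq (c := 1 - δA) h,
    sum_Ico_of_eq (c := 1 - δB) hab, sum_Ico_of_eq (c := 1 - δT) (Nat.le_add_right a b)]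
  · push_cast
    have : 0 ≤ (b : ℝ) * (1 - δT) := mul_nonneg (Nat.cast_nonneg _) (by linarith)
    linarith
  · intro t h1 h2
    simp [schedule, erasureProb, show ¬ t < k by omega, show ¬ t < k + l by omega,
      show ¬ t < a by omega, h2]
  · intro t h1 h2
    simp [schedule, erasureProb, show ¬ t < k by omega, show ¬ t < k + l by omega,
      show ¬ t < a by omega, show ¬ t < a + b by omega]
  · intro t h1 h2
    simp [schedule, erasureProb, show ¬ t < k by omega, show ¬ t < k + l by omega, h2]
  · intro t h1 h2
    have : schedule k l t ≠ none := by
      unfold schedule; split_ifs <;> simp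
    simp [this]

/-- The transient uses are counted generously, as erasure-free and again as part of mode B, at a
cost of O(b). -/
lemma sum_one_sub_erasureProb_le (hT : 0 ≤ δT) (hB : δB ≤ 1) (hab : a + b ≤ n) :
    ∑ t ∈ Finset.range n, (1 - erasureProb δA δT δB a b t) ≤
      a * (1 - δA) + b + (n - a) * (1 - δB) := by
  rw [sum_range_eq_sum_Ico hab, sum_Ico_of_eq (c := 1 - δA) (Nat.zero_le _),
    sum_Ico_of_eq (c := 1 - δT) (Nat.le_add_right a b), sum_Ico_of_eq (c := 1 - δB) hab]
  · push_cast
    have h1 : 0 ≤ (b : ℝ) * δT := mul_nonneg (Nat.cast_nonneg _) hT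
    have h2 : 0 ≤ (b : ℝ) * (1 - δB) := mul_nonneg (Nat.cast_nonneg _) (by linarith)
    linarith
  · intro t h1 h2
    simp [erasureProb, show ¬ t < a by omega, show ¬ t < a + b by omega]
  · intro t h1 h2
    simp [erasureProb, show ¬ t < a by omega, h2]
  · intro t h1 h2
    simp [erasureProb, h2]

open Classical in
lemma sum_exceptional_erasureProb_le (hAB : δB ≤ δA) (hab : a + b ≤ n) :
    (∑ t ∈ Finset.range n, if 1 + erasureProb δA δT δB a b t ≤ 1 + δA then (0 : ℝ) else 1) ≤ b := by
  rw [sum_range_eq_sum_Ico hab, sum_Ico_of_eq (c := 0) (Nat.zero_le _),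
    sum_Ico_of_eq (c := if 1 + δT ≤ 1 + δA then (0 : ℝ) else 1) (Nat.le_add_right a b),
    sum_Ico_of_eq (c := 0) hab]
  · push_cast
    split_ifs <;> simp
  · intro t h1 h2
    simp [erasureProb, show ¬ t < a by omega, show ¬ t < a + b by omega, hAB]
  · intro t h1 h2
    simp [erasureProb, show ¬ t < a by omega, h2]
  · intro t h1 h2
    simp [erasureProb, h2]

end

/-! ### Inner and outer bounds as the blocklength grows -/

lemma tendsto_ceil_div {x : ℝ} (hx : 0 ≤ x) :
    Tendsto (fun n : ℕ => (⌈x * n⌉₊ : ℝ) / n) atTop (𝓝 x) :=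
  (tendsto_nat_ceil_mul_div_atTop hx).comp tendsto_natCast_atTop_atTop

lemma tendsto_msgLen_div {R : Fin 2 → ℝ} {i : Fin 2} (h : 0 ≤ R i) :
    Tendsto (fun n : ℕ => (msgLen R n i : ℝ) / n) atTop (𝓝 (R i)) := by
  have := (tendsto_nat_floor_mul_div_atTop h).comp tendsto_natCast_atTop_atTop
  simpa only [msgLen, mul_comm, Function.comp_def] using this

/-- Rates for which the queueing scheme has dedicated channel uses `x 0 * n` and `x 1 * n` within
mode A, and positive drifts. -/
lemma achievableNonTransientSI_of_drift {δA δB η : ℝ} {nA : ℕ → ℕ} (hA0 : 0 ≤ δA) (hA1 : δA ≤ 1)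
    (hB0 : 0 ≤ δB) (hB1 : δB ≤ 1)
    (hη : Tendsto (fun n => (nA n : ℝ) / (n : ℝ)) atTop (𝓝 η)) {R x : Fin 2 → ℝ}
    (hR : ∀ i, 0 ≤ R i) (hx : ∀ i, 0 ≤ x i) (hfresh : ∀ i, R i < x i * (1 - δA ^ 2))
    (hsum : x 0 + x 1 < η)
    (hover : ∀ i, x i * (δA * (1 - δA)) <
      (η - (x 0 + x 1)) * (1 - δA) + (1 - η) * (1 - δB)) :
    AchievableNonTransientSI δA δB nA R := by
  let L (n : ℕ) (i : Fin 2) : ℕ := ⌈x i * n⌉₊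
  refine ⟨hR, fun n => queueEncoder (schedule (L n 0) (L n 1)) n (msgLen R n), ?_⟩
  -- The encoders are already fixed at this point, so they cannot depend on the transient mode; only
  -- the margin `g` and the error estimate come after it.
  intro δT nT hT0 hT1 hT i
  refine ⟨fun n =>
    consistentDecoder (queueEncoder (schedule (L n 0) (L n 1)) n (msgLen R n)) i, ?_⟩
  have hL : ∀ i, Tendsto (fun n => (L n i : ℝ) / n) atTop (𝓝 (x i)) :=
    fun i => tendsto_ceil_div (hx i)
  have lim1 : Tendsto (fun n : ℕ => (L n i : ℝ) / n * (1 - δA ^ 2) - (msgLen R n i : ℝ) / n)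
      atTop (𝓝 (x i * (1 - δA ^ 2) - R i)) :=
    ((hL i).mul_const _).sub (tendsto_msgLen_div (hR i))
  have lim2 : Tendsto (fun n : ℕ => ((nA n : ℝ) / n - ((L n 0 : ℝ) / n + (L n 1 : ℝ) / n)) *
      (1 - δA) + (1 - ((nA n : ℝ) / n + (nT n : ℝ) / n)) * (1 - δB) -
      (L n i : ℝ) / n * (δA * (1 - δA)))
      atTop (𝓝 ((η - (x 0 + x 1)) * (1 - δA) + (1 - (η + 0)) * (1 - δB) -
        x i * (δA * (1 - δA)))) :=
    (((hη.sub ((hL 0).add (hL 1))).mul_const _).add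
      ((tendsto_const_nhds.sub (hη.add hT.2)).mul_const _)).sub ((hL i).mul_const _)
  have lim3 : Tendsto (fun n : ℕ => (nA n : ℝ) / n - ((L n 0 : ℝ) / n + (L n 1 : ℝ) / n))
      atTop (𝓝 (η - (x 0 + x 1))) := hη.sub ((hL 0).add (hL 1))
  have hf := hfresh i
  have ho := hover i
  obtain ⟨g, hg0, hg1, hg2⟩ : ∃ g : ℝ, 0 < g ∧ g < x i * (1 - δA ^ 2) - R i ∧
      2 * g < (η - (x 0 + x 1)) * (1 - δA) + (1 - (η + 0)) * (1 - δB) -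
        x i * (δA * (1 - δA)) := by
    obtain ⟨g, hg0, hg⟩ := exists_between (lt_min (sub_pos.2 hf) (half_pos (sub_pos.2 ho)))
    have := hg.trans_le (min_le_left _ _)
    have := hg.trans_le (min_le_right _ _)
    exact ⟨g, hg0, by linarith, by linarith⟩
  have hbound : ∀ᶠ n : ℕ in atTop,
      errorProb (erasureProb δA δT δB (nA n) (nT n))
        (queueEncoder (schedule (L n 0) (L n 1)) n (msgLen R n)) i
        (consistentDecoder (queueEncoder (schedule (L n 0) (L n 1)) n (msgLen R n)) i) ≤
      3 / g ^ 2 / n := by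
    filter_upwards [lim1.eventually_const_lt hg1, lim2.eventually_const_lt hg2,
      lim3.eventually_const_lt (sub_pos.2 hsum), eventually_gt_atTop 0] with n e1 e2 e3 hn
    have hn' : (0 : ℝ) < n := by exact_mod_cast hn
    have e1' : msgLen R n i + g * n < L n i * (1 - δA ^ 2) := by
      have := mul_lt_mul_of_pos_right e1 hn'
      field_simp at this
      linarith
    have e2' : L n i * (δA * (1 - δA)) + 2 * (g * n) <
        (nA n - (L n 0 + L n 1)) * (1 - δA) + (n - (nA n + nT n)) * (1 - δB) := by
      have := mul_lt_mul_of_pos_right e2 hn'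
      field_simp at this
      linarith
    have e3' : L n 0 + L n 1 ≤ nA n := by
      have := mul_lt_mul_of_pos_right e3 hn'
      field_simp at this
      have : (L n 0 + L n 1 : ℝ) ≤ nA n := by linarith
      exact_mod_cast this
    have hTn := hT.1 n
    have hle : L n 0 + L n 1 ≤ n := by omega
    have hmode : ∀ t < L n 0 + L n 1, erasureProb δA δT δB (nA n) (nT n) t = δA := by
      intro t ht
      simp [erasureProb, show t < nA n by omega]
    refine (errorProb_queueEncoder_le (erasureProb_nonneg hA0 hT0 hB0)
      (erasureProb_le_one hA1 hT1 hB1) (fun _ _ => schedule_none) i (mul_pos hg0 hn')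
      ?_ ?_).trans_eq ?_
    · rw [sum_schedule_some hle i (c := 1 - δA ^ 2) fun t ht => by rw [hmode t ht]]
      exact e1'.le
    · rw [sum_schedule_some hle i (c := δA * (1 - δA)) fun t ht => by rw [hmode t ht]]
      refine e2'.le.trans ?_
      exact_mod_cast le_sum_schedule_none hT1 e3' hTn
    · field_simp
  exact squeeze_zero' (Eventually.of_forall fun n =>
    errorProb_nonneg (erasureProb_nonneg hA0 hT0 hB0) (erasureProb_le_one hA1 hT1 hB1) _ _ _)
    hbound (tendsto_const_div_atTop_nhds_zero_nat _)

/-- The weighted sum-rate bound. -/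
lemma Achievable.weighted_sum_le {δA δT δB η : ℝ} {nA nT : ℕ → ℕ} (hA0 : 0 ≤ δA) (hA1 : δA ≤ 1)
    (hB0 : 0 ≤ δB) (hAB : δB ≤ δA) (hT0 : 0 ≤ δT) (hT1 : δT ≤ 1)
    (hη : Tendsto (fun n => (nA n : ℝ) / (n : ℝ)) atTop (𝓝 η)) (hT : IsTransient nA nT)
    {R : Fin 2 → ℝ} (hR : Achievable δA δT δB nA nT R) {i j : Fin 2} (hij : i ≠ j) :
    (1 + δA) * R i + R j ≤ (1 + δA) * (1 - avgErasure δA δB η) := by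
  obtain ⟨hR0, enc, hdec⟩ := hR
  obtain ⟨deci, hi⟩ := hdec i
  obtain ⟨decj, hj⟩ := hdec j
  have hone : Tendsto (fun n : ℕ => (1 + δA + 1) / (n : ℝ)) atTop (𝓝 0) :=
    tendsto_const_div_atTop_nhds_zero_nat _
  have lhs := (((tendsto_msgLen_div (hR0 i)).mul
    (tendsto_const_nhds (x := (1 : ℝ)).sub hi)).const_mul (1 + δA)).add
    ((tendsto_msgLen_div (hR0 j)).mul (tendsto_const_nhds (x := (1 : ℝ)).sub hj))
  have rhs := ((((hη.mul_const (1 - δA)).add hT.2).add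
    ((tendsto_const_nhds (x := (1 : ℝ)).sub hη).mul_const (1 - δB))).const_mul (1 + δA)).add
    hone |>.add (hT.2.const_mul (1 + δA + 1))
  have h := le_of_tendsto_of_tendsto lhs rhs ?_
  · rw [avgErasure]
    linarith
  · filter_upwards [eventually_gt_atTop 0] with n hn
    have hn' : (0 : ℝ) < n := by exact_mod_cast hn
    have hc := converse_bound (enc n) (δ := erasureProb δA δT δB (nA n) (nT n))
      (erasureProb_nonneg hA0 hT0 hB0) (erasureProb_le_one hA1 hT1 (hAB.trans hA1)) hij
      (β := 1 + δA) (by linarith) (deci n) (decj n)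
    have h1 := mul_le_mul_of_nonneg_left (sum_one_sub_erasureProb_le (δA := δA) hT0
      (hAB.trans hA1) (hT.1 n)) (show 0 ≤ 1 + δA by linarith)
    have h2 := mul_le_mul_of_nonneg_left (sum_exceptional_erasureProb_le (δT := δT) hAB (hT.1 n))
      (show 0 ≤ 1 + δA + 1 by linarith)
    have h3 := (hc.trans (add_le_add (add_le_add h1 le_rfl) h2))
    have h4 := div_le_div_of_nonneg_right h3 hn'.le
    convert h4 using 1 <;> field_simp

/-- Covers δA = 1, where C₁ shrinks to the origin and the dedicated phases would need a division by
1 - δA² = 0. -/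
lemma achievableNonTransientSI_zero (δA δB : ℝ) (nA : ℕ → ℕ) :
    AchievableNonTransientSI δA δB nA 0 := by
  refine ⟨fun _ => le_rfl, fun n _ _ _ => 0, fun δT nT _ _ _ i => ⟨fun n _ _ => 0, ?_⟩⟩
  have : ∀ n, IsEmpty (Fin (msgLen 0 n i)) := fun n => by
    simp only [msgLen, Pi.zero_apply, mul_zero, Nat.floor_zero]
    infer_instance
  simp [errorProb, Subsingleton.elim _ (0 : Fin (msgLen 0 _ i) → ZMod 2)]

lemma AchievableNonTransientSI.achievable {δA δT δB : ℝ} {nA nT : ℕ → ℕ} {R : Fin 2 → ℝ}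
    (h : AchievableNonTransientSI δA δB nA R) (hT0 : 0 ≤ δT) (hT1 : δT ≤ 1)
    (hT : IsTransient nA nT) : Achievable δA δT δB nA nT R :=
  ⟨h.1, h.2.imp fun _ he => he δT nT hT0 hT1 hT⟩

lemma isClosed_regionC1 (δA δB η : ℝ) : IsClosed (regionC1 δA δB η) := by
  refine IsClosed.and ?_ (IsClosed.and ?_ (IsClosed.and ?_ ?_)) <;>
    exact isClosed_le (by fun_prop) (by fun_prop)

/-- With `x i` slightly above Rᵢ/(1 - δA²), multiplying the drift condition of the overheard queue
by (1 + δA)/(1 - δA) and using 1 - δA² = (1 - δA)(1 + δA) turns it into a facet of C₁. -/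
lemma achievableNonTransientSI_of_lt {δA δB η : ℝ} {nA : ℕ → ℕ} (hA0 : 0 ≤ δA) (hA1 : δA < 1)
    (hB0 : 0 ≤ δB) (hB1 : δB ≤ 1)
    (hη : Tendsto (fun n => (nA n : ℝ) / (n : ℝ)) atTop (𝓝 η)) {R : Fin 2 → ℝ}
    (hR : ∀ i, 0 ≤ R i) (hsum : R 0 + R 1 < η * (1 - δA ^ 2))
    (h0 : (1 + δA) * R 0 + R 1 < (1 + δA) * (1 - avgErasure δA δB η))
    (h1 : R 0 + (1 + δA) * R 1 < (1 + δA) * (1 - avgErasure δA δB η)) :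
    AchievableNonTransientSI δA δB nA R := by
  have hd : 0 < 1 - δA ^ 2 := by nlinarith
  have hp : 0 < 1 + δA := by linarith
  obtain ⟨e, he0, he⟩ := exists_between (lt_min (lt_min (sub_pos.2 h0) (sub_pos.2 h1))
    (sub_pos.2 hsum))
  have he1 := he.trans_le ((min_le_left _ _).trans (min_le_left _ _))
  have he2 := he.trans_le ((min_le_left _ _).trans (min_le_right _ _))
  have he3 := he.trans_le (min_le_right _ _)
  have hxd : ∀ i, (R i + e / 6) / (1 - δA ^ 2) * (1 - δA) = (R i + e / 6) / (1 + δA) := by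
    intro i
    have : 1 - δA ^ 2 = (1 - δA) * (1 + δA) := by ring
    have h2 : 1 - δA ≠ 0 := by linarith
    rw [this]
    field_simp
  -- The excess `e / 6` costs (2 + δA) e / 6 ≤ e / 2 in each facet and e / 3 in the sum constraint,
  -- within the slack `e`.
  refine achievableNonTransientSI_of_drift hA0 hA1.le hB0 hB1 hη hR
    (x := fun i => (R i + e / 6) / (1 - δA ^ 2))
    (fun i => div_nonneg (by linarith [hR i]) hd.le) (fun i => ?_) ?_ (fun i => ?_)
  · rw [div_mul_cancel₀ _ hd.ne']
    linarith
  · rw [← add_div, div_lt_iff₀ hd]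
    linarith
  · have key : (R i + e / 6) / (1 + δA) * δA + ((R 0 + e / 6) / (1 + δA) +
        (R 1 + e / 6) / (1 + δA)) < 1 - avgErasure δA δB η := by
      rw [div_mul_eq_mul_div, ← add_div, ← add_div, div_lt_iff₀ hp]
      have := mul_nonneg he0.le (by linarith : 0 ≤ 1 - δA)
      fin_cases i
      · simp only [Fin.zero_eta]
        linarith
      · simp only [Fin.mk_one]
        linarith
    rw [avgErasure] at key
    have e1 := hxd i
    have e2 := hxd 0
    have e3 := hxd 1
    rw [← e1, ← e2, ← e3] at key
    linarith

/-! ### Geometry of the regions under the condition on η -/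

section

variable {δA δB η : ℝ}

/-- The condition on `η` says that both dedicated phases fit into mode A. -/
lemma one_sub_avgErasure_le (hB1 : δB < 1) (hA0 : 0 ≤ δA) (hA1 : δA ≤ 1)
    (hcond : (1 + δA * (1 - δA) / (2 * (1 - δB)))⁻¹ ≤ η) :
    1 - avgErasure δA δB η ≤ η * (1 - δA) * (2 + δA) / 2 := by
  have hb : 0 < 1 - δB := by linarith
  have hD : 0 < 1 + δA * (1 - δA) / (2 * (1 - δB)) := by
    have : 0 ≤ δA * (1 - δA) := mul_nonneg hA0 (by linarith)
    positivity
  rw [inv_le_iff_one_le_mul₀ hD] at hcond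
  have := mul_le_mul_of_nonneg_right hcond (show 0 ≤ 2 * (1 - δB) by linarith)
  have e : η * (1 + δA * (1 - δA) / (2 * (1 - δB))) * (2 * (1 - δB)) =
      η * (2 * (1 - δB) + δA * (1 - δA)) := by
    field_simp
  rw [e] at this
  rw [avgErasure]
  linarith

/-- Adding the two facets gives both rates the same weight 2 + δA. -/
lemma add_le_of_mem_regionC1 (hA0 : 0 ≤ δA) (hAB : δB ≤ δA) {R : Fin 2 → ℝ}
    (hR : R ∈ regionC1 δA δB η) :
    R 0 + R 1 ≤ 2 * ((1 + δA) * (1 - avgErasure δA δB η) / (2 + δA)) := by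
  obtain ⟨-, -, h2, h3⟩ := hR
  rw [betaMax, max_eq_left (by linarith)] at h2 h3
  rw [← mul_div_assoc, le_div_iff₀ (by linarith)]
  linarith

lemma add_le_mode_A (hB1 : δB < 1) (hA0 : 0 ≤ δA) (hA1 : δA ≤ 1) (hAB : δB ≤ δA)
    (hcond : (1 + δA * (1 - δA) / (2 * (1 - δB)))⁻¹ ≤ η) {R : Fin 2 → ℝ}
    (hR : R ∈ regionC1 δA δB η) : R 0 + R 1 ≤ η * (1 - δA ^ 2) := by
  have h1 := add_le_of_mem_regionC1 hA0 hAB hR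
  have h2 := one_sub_avgErasure_le hB1 hA0 hA1 hcond
  refine h1.trans ?_
  rw [← mul_div_assoc, div_le_iff₀ (by linarith)]
  have := mul_le_mul_of_nonneg_left h2 (by linarith : 0 ≤ 2 * (1 + δA))
  linarith

lemma outerBound_eq_regionC1 (hB0 : 0 ≤ δB) (hB1 : δB < 1) (hA1 : δA ≤ 1) (hAB : δB ≤ δA)
    (hη1 : η ≤ 1) (hcond : (1 + δA * (1 - δA) / (2 * (1 - δB)))⁻¹ ≤ η) :
    outerBound δA δB η = regionC1 δA δB η := by
  have hA0 : 0 ≤ δA := hB0.trans hAB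
  have hp : 0 < 1 + δA := by linarith
  refine Set.Subset.antisymm (fun R hR => hR.1.1) fun R hR => ?_
  have hsum := add_le_of_mem_regionC1 hA0 hAB hR
  have hsumA := add_le_mode_A hB1 hA0 hA1 hAB hcond hR
  have hc := one_sub_avgErasure_le hB1 hA0 hA1 hcond
  have hR' := hR
  obtain ⟨h0, h1, h2, h3⟩ := hR'
  rw [betaMax, max_eq_left (by linarith)] at h2 h3
  set c := 1 - avgErasure δA δB η with hcdef
  have hle0 : R 0 ≤ c := le_of_mul_le_mul_left (by linarith) hp
  have hle1 : R 1 ≤ c := le_of_mul_le_mul_left (by linarith) hp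
  have hle : ∀ i, 0 ≤ R i ∧ R i ≤ c := by
    intro i
    fin_cases i
    · exact ⟨h0, hle0⟩
    · exact ⟨h1, hle1⟩
  have hηB : 0 ≤ (1 - η) * (1 - δB) := mul_nonneg (by linarith) (by linarith)
  have hc0 : 0 ≤ c := h0.trans hle0
  have hηA : 0 ≤ η * (1 - δA) := by
    by_contra! hneg
    nlinarith
  have hκ : η * (1 - δA) ≤ kappa δA δB η := by
    have e1 : η / (1 + δA) * (1 - δA ^ 2) = η * (1 - δA) := by
      field_simp
      ring
    have e2 : (1 - η) / (1 + δB) * (1 - δB ^ 2) = (1 - η) * (1 - δB) := by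
      have : 1 + δB ≠ 0 := by linarith
      field_simp
      ring
    rw [kappa, if_pos (max_eq_left hAB), e1, e2]
    split_ifs <;> linarith
  -- Here 2(1 + δA)/(2 + δA) = 1 + δA/(2 + δA), and `hc` bounds the excess over `c` by η δA(1 -
  -- δA)/2. Adding δB Rᵢ ≤ δB c then yields the facets of C₂.
  have hslack : R 0 + R 1 ≤ c + η * (1 - δA) := by
    refine hsum.trans ?_
    rw [← mul_div_assoc, div_le_iff₀ (by linarith)]
    have := mul_le_mul_of_nonneg_left hc hA0
    nlinarith
  have hβ : betaMin δA δB = 1 + δB := min_eq_right (by linarith)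
  have m0 := mul_le_mul_of_nonneg_left hle0 hB0
  have m1 := mul_le_mul_of_nonneg_left hle1 hB0
  refine ⟨⟨hR, hle, ?_, ?_⟩, hle, by linarith, ?_⟩
  · rw [hβ]
    linarith
  · rw [hβ]
    linarith
  · have : 0 ≤ (1 - η) * (1 - δB) * (1 + δB) := mul_nonneg hηB (by linarith)
    linarith

lemma regionC1_subset_closure {nA : ℕ → ℕ} (hB0 : 0 ≤ δB) (hB1 : δB < 1) (hA1 : δA ≤ 1)
    (hAB : δB ≤ δA) (hη : Tendsto (fun n => (nA n : ℝ) / (n : ℝ)) atTop (𝓝 η)) (hη1 : η ≤ 1)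
    (hcond : (1 + δA * (1 - δA) / (2 * (1 - δB)))⁻¹ ≤ η) :
    regionC1 δA δB η ⊆ capacityRegionNonTransientSI δA δB nA := by
  intro R hR
  have hA0 : 0 ≤ δA := hB0.trans hAB
  have hsum := add_le_mode_A hB1 hA0 hA1 hAB hcond hR
  obtain ⟨h0, h1, h2, h3⟩ := hR
  rcases hA1.eq_or_lt with rfl | hA1
  · have hz : R = 0 := by
      ext i
      fin_cases i
      · simp only [Fin.zero_eta, Pi.zero_apply]
        linarith
      · simp only [Fin.mk_one, Pi.zero_apply]
        linarith
    rw [hz]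
    exact subset_closure (achievableNonTransientSI_zero _ _ _)
  · rw [betaMax, max_eq_left (by linarith)] at h2 h3
    have hη0 : 0 < η := by
      refine lt_of_lt_of_le (inv_pos.2 ?_) hcond
      have : 0 ≤ δA * (1 - δA) := mul_nonneg hA0 (by linarith)
      have : 0 < 1 - δB := by linarith
      positivity
    have hc : 0 < (1 + δA) * (1 - avgErasure δA δB η) := by
      refine mul_pos (by linarith) ?_
      have e1 := mul_pos hη0 (sub_pos.2 hA1)
      have e2 : 0 ≤ (1 - η) * (1 - δB) := mul_nonneg (by linarith) (by linarith)
      rw [avgErasure]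
      linarith
    have hd : 0 < η * (1 - δA ^ 2) := mul_pos hη0 (by nlinarith)
    -- For δA < 1 all three right-hand sides are positive, so shrinking a rate pair towards the
    -- origin makes its constraints strict.
    have scale : ∀ {θ x y : ℝ}, 0 < θ → θ < 1 → x ≤ y → 0 < y → (1 - θ) * x < y := by
      intro θ x y h1 h2 hxy hy
      nlinarith
    have hlim : Tendsto (fun θ : ℝ => fun i => (1 - θ) * R i) (𝓝[>] 0) (𝓝 R) := by
      have : Continuous fun θ : ℝ => fun i => (1 - θ) * R i := by fun_prop
      have h := (this.tendsto 0).mono_left (nhdsWithin_le_nhds (s := Set.Ioi 0))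
      simpa using h
    refine mem_closure_of_tendsto hlim ?_
    filter_upwards [Ioo_mem_nhdsGT (zero_lt_one' ℝ)] with θ hθ
    have hθ' : 0 ≤ 1 - θ := by linarith [hθ.2]
    refine achievableNonTransientSI_of_lt hA0 hA1 hB0 hB1.le hη (fun i => ?_) ?_ ?_ ?_
    · refine mul_nonneg hθ' ?_
      fin_cases i
      · exact h0
      · exact h1
    · linarith [scale hθ.1 hθ.2 hsum hd]
    · linarith [scale hθ.1 hθ.2 h2 hc]
    · linarith [scale hθ.1 hθ.2 h3 hc]

lemma capacityRegion_subset_regionC1 {δT : ℝ} {nA nT : ℕ → ℕ} (hB0 : 0 ≤ δB) (hA1 : δA ≤ 1)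
    (hAB : δB ≤ δA) (hη : Tendsto (fun n => (nA n : ℝ) / (n : ℝ)) atTop (𝓝 η))
    (hT0 : 0 ≤ δT) (hT1 : δT ≤ 1) (hT : IsTransient nA nT) :
    capacityRegion δA δT δB nA nT ⊆ regionC1 δA δB η := by
  have hA0 : 0 ≤ δA := hB0.trans hAB
  refine closure_minimal (fun R hR => ?_) (isClosed_regionC1 _ _ _)
  have a := Achievable.weighted_sum_le hA0 hA1 hB0 hAB hT0 hT1 hη hT hR zero_ne_one
  have b := Achievable.weighted_sum_le hA0 hA1 hB0 hAB hT0 hT1 hη hT hR one_ne_zero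
  have hβ : betaMax δA δB = 1 + δA := max_eq_left (by linarith)
  refine ⟨hR.1 0, hR.1 1, ?_, ?_⟩ <;> rw [hβ] <;> linarith

end

end BPEC

end

theorem theorem2 (δA δB η : ℝ) (nA : ℕ → ℕ)
    (hB0 : 0 ≤ δB) (hB1 : δB < 1) (hA1 : δA ≤ 1)
    (hnA : ∀ n, nA n ≤ n)
    (hη : Tendsto (fun n => (nA n : ℝ) / (n : ℝ)) atTop (𝓝 η))
    (hAB : δB ≤ δA)
    (hcond : (1 + δA * (1 - δA) / (2 * (1 - δB)))⁻¹ ≤ η) :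
    -- the outer-bound region reduces to its first constituent
    BPEC.outerBound δA δB η = BPEC.regionC1 δA δB η ∧
    -- it is the capacity region, whatever the transient mode is
    (∀ (δT : ℝ) (nT : ℕ → ℕ), 0 ≤ δT → δT ≤ 1 → BPEC.IsTransient nA nT →
      BPEC.capacityRegion δA δT δB nA nT = BPEC.outerBound δA δB η) ∧
    -- side information about the non-transient modes suffices at the transmitter
    BPEC.capacityRegionNonTransientSI δA δB nA = BPEC.outerBound δA δB η ∧
    -- the symmetric point is reached with that side information, and maximizes the sum-rate
    (fun _ => (1 + δA) * (1 - BPEC.avgErasure δA δB η) / (2 + δA)) ∈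
      BPEC.capacityRegionNonTransientSI δA δB nA ∧
    (∀ R ∈ BPEC.capacityRegionNonTransientSI δA δB nA,
      R 0 + R 1 ≤ 2 * ((1 + δA) * (1 - BPEC.avgErasure δA δB η) / (2 + δA))) := by
  have hA0 : 0 ≤ δA := hB0.trans hAB
  have hη1 : η ≤ 1 := le_of_tendsto' hη fun n =>
    div_le_one_of_le₀ (by exact_mod_cast hnA n) (Nat.cast_nonneg n)
  have hO := BPEC.outerBound_eq_regionC1 hB0 hB1 hA1 hAB hη1 hcond
  have hin := BPEC.regionC1_subset_closure hB0 hB1 hA1 hAB hη hη1 hcond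
  have hmono : ∀ (δT : ℝ) (nT : ℕ → ℕ), 0 ≤ δT → δT ≤ 1 → BPEC.IsTransient nA nT →
      BPEC.capacityRegionNonTransientSI δA δB nA ⊆ BPEC.capacityRegion δA δT δB nA nT :=
    fun δT nT hT0 hT1 hT => closure_mono fun R hR => hR.achievable hT0 hT1 hT
  have hout : ∀ (δT : ℝ) (nT : ℕ → ℕ), 0 ≤ δT → δT ≤ 1 → BPEC.IsTransient nA nT →
      BPEC.capacityRegion δA δT δB nA nT ⊆ BPEC.regionC1 δA δB η :=
    fun δT nT hT0 hT1 hT => BPEC.capacityRegion_subset_regionC1 hB0 hA1 hAB hη hT0 hT1 hT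
  -- C′ requires success for every transient mode, so its outer bound may be read off from a single
  -- one; the empty mode always qualifies.
  have hzero : BPEC.IsTransient nA (fun _ => 0) := ⟨by simpa using hnA, by simp⟩
  have hSI : BPEC.capacityRegionNonTransientSI δA δB nA = BPEC.regionC1 δA δB η :=
    ((hmono 0 _ le_rfl zero_le_one hzero).trans
      (hout 0 _ le_rfl zero_le_one hzero)).antisymm hin
  rw [hO, hSI]
  refine ⟨rfl, fun δT nT hT0 hT1 hT => (hout δT nT hT0 hT1 hT).antisymm
    (hin.trans (hmono δT nT hT0 hT1 hT)), rfl, ?_,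
    fun R hR => BPEC.add_le_of_mem_regionC1 hA0 hAB hR⟩
  have hc : 0 ≤ 1 - BPEC.avgErasure δA δB η := by
    have h1 : 0 ≤ η := ge_of_tendsto' hη fun n => by positivity
    have h2 := mul_nonneg h1 (sub_nonneg.2 hA1)
    have h3 := mul_nonneg (sub_nonneg.2 hη1) (sub_nonneg.2 hB1.le)
    rw [BPEC.avgErasure]
    linarith
  have hβ : BPEC.betaMax δA δB = 1 + δA := max_eq_left (by linarith)
  have hp : 2 + δA ≠ 0 := by linarith
  refine ⟨by positivity, by positivity, ?_, ?_⟩ <;>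
  · rw [hβ]
    refine le_of_eq ?_
    field_simp
    ring
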